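/- Work over $\mathbb{C}$. A variety $X\subset\mathbb{P}^n$ is a Zariski closed subset, possibly reducible. For points $p=[a_0:\dots:a_n]$, $q=[b_0:\dots:b_n]$ with $a_ib_i\neq 0$ for some $i$, the Hadamard product $p\star q=[a_0b_0:\dots:a_nb_n]$ is defined; products of several points are defined likewise, the empty product being $[1:\dots:1]$. For a set $A\subset\mathbb{P}^n$ put $p\star A=\{p\star a: a\in A,\ p\star a \text{ defined}\}$. For varieties $X,Y\subset\mathbb{P}^n$, $X\star Y$ is the Zariski closure of $\{p\star q: p\in X,\ q\in Y,\ p\star q\text{ defined}\}$; $X^{\star 0}=\{[1:\dots:1]\}$ and $X^{\star r}=X\star X^{\star(r-1)}$. $T_p(X)\subset\mathbb{P}^n$ is the embedded projective tangent space, defined by the linear equations $\sum_i \frac{\partial f}{\partial x_i}(p)\,x_i=0$ for all homogeneous $f$ vanishing on $X$, and $\langle\,\cdot\,\rangle$ denotes projective linear span. (Hadamard version of Terracini's lemma.) (1) Let $X,Y\subset\mathbb{P}^n$ be varieties. There are Zariski open dense subsets $U\subset X\times Y$ and $V\subset X\star Y$ such that for all $(p,q)\in U$ with $p\star q$ defined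 and $p\star q\in V$, \[T_{p\star q}(X\star Y)=\langle p\star T_q(Y),\; q\star T_p(X)\rangle .\] If $X$ and $Y$ are irreducible, one can take $V=X\star Y$. (2) Let $X\subset\mathbb{P}^n$ be a variety and $r\ge 1$. There are Zariski open dense subsets $U\subset X^r$ and $V\subset X^{\star r}$ such that for all $(p_1,\dots,p_r)\in U$ with $p_1\star\dots\star p_r$ defined and in $V$, \[T_{p_1\star\dots\star p_r}(X^{\star r})=\langle p_2\star\dots\star p_r\star T_{p_1}(X),\;\dots,\;p_1\star\dots\star p_{r-1}\star T_{p_r}(X)\rangle ,\] where in the $i$-th term the factor $p_i$ is omitted. If $X$ is irreducible, one can take $V=X^{\star r}$. -/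

import Mathlib

open scoped LinearAlgebra.Projectivization Topology

noncomputable section

namespace HadamardTerracini

/-- Complex projective space `ℙⁿ`, with homogeneous coordinates indexed by `0, …, n`. -/
abbrev PSpace (n : ℕ) : Type := ℙ ℂ (Fin (n + 1) → ℂ)

/-- The common zeros in `ℙⁿ` of a set of (homogeneous) polynomials. -/
def zeroLocus {n : ℕ} (S : Set (MvPolynomial (Fin (n + 1)) ℂ)) : Set (PSpace n) :=
  {p | ∀ f ∈ S, MvPolynomial.eval p.rep f = 0}

/-- The Zariski topology on `ℙⁿ`: the closed sets are the common zero sets of sets of homogeneous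
polynomials. -/
@[reducible] def zariski (n : ℕ) : TopologicalSpace (PSpace n) :=
  TopologicalSpace.ofClosed
    {Z | ∃ S : Set (MvPolynomial (Fin (n + 1)) ℂ),
      (∀ f ∈ S, ∃ d : ℕ, f.IsHomogeneous d) ∧ Z = zeroLocus S}
    ⟨{1}, by
      rintro f rfl
      exact ⟨0, MvPolynomial.isHomogeneous_one _ _⟩, by
      ext p
      simp [zeroLocus]⟩
    (by
      intro A hA
      have hA' : ∀ Z ∈ A, ∃ S : Set (MvPolynomial (Fin (n + 1)) ℂ),
          (∀ f ∈ S, ∃ d : ℕ, f.IsHomogeneous d) ∧ Z = zeroLocus S := fun Z hZ => hA hZ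
      choose! S hS hZ using hA'
      refine ⟨⋃ Z ∈ A, S Z, ?_, ?_⟩
      · intro f hf
        simp only [Set.mem_iUnion] at hf
        obtain ⟨Z, hZA, hf⟩ := hf
        exact hS Z hZA f hf
      · ext p
        simp only [Set.mem_sInter, zeroLocus, Set.mem_iUnion, Set.mem_ofPred_eq]
        constructor
        · rintro h f ⟨Z, hZA, hf⟩
          have h1 := h Z hZA
          rw [hZ Z hZA] at h1
          exact h1 f hf
        · intro h Z hZA
          rw [hZ Z hZA]
          exact fun f hf => h f ⟨Z, hZA, hf⟩)
    (by
      rintro _ ⟨S, hS, rfl⟩ _ ⟨T, hT, rfl⟩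
      refine ⟨{h | ∃ f ∈ S, ∃ g ∈ T, h = f * g}, ?_, ?_⟩
      · rintro _ ⟨f, hf, g, hg, rfl⟩
        obtain ⟨d, hd⟩ := hS f hf
        obtain ⟨e, he⟩ := hT g hg
        exact ⟨d + e, hd.mul he⟩
      · ext p
        constructor
        · rintro (h | h) _ ⟨f, hf, g, hg, rfl⟩
          · simp [h f hf]
          · simp [h g hg]
        · intro h
          by_contra hc
          simp only [Set.mem_union, zeroLocus, Set.mem_ofPred_eq, not_or, not_forall] at hc
          obtain ⟨⟨f, hf, hf0⟩, ⟨g, hg, hg0⟩⟩ := hc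
          have h1 := h (f * g) ⟨f, hf, g, hg, rfl⟩
          rw [map_mul] at h1
          exact (mul_ne_zero hf0 hg0) h1)

/-- The common zeros in `∏_{i ∈ ι} ℙⁿ` of a set of (multihomogeneous) polynomials in the
coordinates `x_{i,j}`, where `x_{i,0}, …, x_{i,n}` are the coordinates on the `i`-th factor. -/
def multiZeroLocus {ι : Type} {n : ℕ} (S : Set (MvPolynomial (ι × Fin (n + 1)) ℂ)) :
    Set (ι → PSpace n) :=
  {p | ∀ f ∈ S, MvPolynomial.eval (fun k : ι × Fin (n + 1) => (p k.1).rep k.2) f = 0}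

/-- `f` is multihomogeneous of multidegree `d`: homogeneous of degree `d i` in the `i`-th group of
variables, for each `i`. -/
def IsMultihomogeneous {ι : Type} [DecidableEq ι] {n : ℕ}
    (f : MvPolynomial (ι × Fin (n + 1)) ℂ) (d : ι → ℕ) : Prop :=
  f.IsWeightedHomogeneous (fun k : ι × Fin (n + 1) => (Pi.single k.1 1 : ι → ℕ)) d

/-- The Zariski topology on the product variety `∏_{i ∈ ι} ℙⁿ`: the closed sets are the common zero
sets of sets of multihomogeneous polynomials (this is the topology induced by the Segre embedding,
not the product topology). -/
@[reducible] def multiZariski (ι : Type) [DecidableEq ι] (n : ℕ) : TopologicalSpace (ι → PSpace n) :=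
  TopologicalSpace.ofClosed
    {Z | ∃ S : Set (MvPolynomial (ι × Fin (n + 1)) ℂ),
      (∀ f ∈ S, ∃ d : ι → ℕ, IsMultihomogeneous f d) ∧ Z = multiZeroLocus S}
    ⟨{1}, by
      rintro f rfl
      exact ⟨0, MvPolynomial.isWeightedHomogeneous_one _ _⟩, by
      ext p
      simp [multiZeroLocus]⟩
    (by
      intro A hA
      have hA' : ∀ Z ∈ A, ∃ S : Set (MvPolynomial (ι × Fin (n + 1)) ℂ),
          (∀ f ∈ S, ∃ d : ι → ℕ, IsMultihomogeneous f d) ∧ Z = multiZeroLocus S :=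
        fun Z hZ => hA hZ
      choose! S hS hZ using hA'
      refine ⟨⋃ Z ∈ A, S Z, ?_, ?_⟩
      · intro f hf
        simp only [Set.mem_iUnion] at hf
        obtain ⟨Z, hZA, hf⟩ := hf
        exact hS Z hZA f hf
      · ext p
        simp only [Set.mem_sInter, multiZeroLocus, Set.mem_iUnion, Set.mem_ofPred_eq]
        constructor
        · rintro h f ⟨Z, hZA, hf⟩
          have h1 := h Z hZA
          rw [hZ Z hZA] at h1
          exact h1 f hf
        · intro h Z hZA
          rw [hZ Z hZA]
          exact fun f hf => h f ⟨Z, hZA, hf⟩)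
    (by
      rintro _ ⟨S, hS, rfl⟩ _ ⟨T, hT, rfl⟩
      refine ⟨{h | ∃ f ∈ S, ∃ g ∈ T, h = f * g}, ?_, ?_⟩
      · rintro _ ⟨f, hf, g, hg, rfl⟩
        obtain ⟨d, hd⟩ := hS f hf
        obtain ⟨e, he⟩ := hT g hg
        exact ⟨d + e, MvPolynomial.IsWeightedHomogeneous.mul hd he⟩
      · ext p
        constructor
        · rintro (h | h) _ ⟨f, hf, g, hg, rfl⟩
          · simp [h f hf]
          · simp [h g hg]
        · intro h
          by_contra hc
          simp only [Set.mem_union, multiZeroLocus, Set.mem_ofPred_eq, not_or, not_forall] at hc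
          obtain ⟨⟨f, hf, hf0⟩, ⟨g, hg, hg0⟩⟩ := hc
          have h1 := h (f * g) ⟨f, hf, g, hg, rfl⟩
          rw [map_mul] at h1
          exact (mul_ne_zero hf0 hg0) h1)

/-- `X ⊆ ℙⁿ` is a projective variety: a Zariski closed subset (possibly reducible). -/
def IsVariety {n : ℕ} (X : Set (PSpace n)) : Prop := IsClosed[zariski n] X

/-- `X ⊆ ℙⁿ` is irreducible (and nonempty) in the Zariski topology. -/
def IsIrred {n : ℕ} (X : Set (PSpace n)) : Prop := @IsIrreducible (PSpace n) (zariski n) X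

/-- `U` is a dense open subset of the subspace `Z`, for the topology that `t` induces on `Z`. A
property holds for a general point of `Z` when it holds on such a subset. -/
def IsDenseOpenIn {α : Type} (t : TopologicalSpace α) (Z U : Set α) : Prop :=
  (∃ O : Set α, IsOpen[t] O ∧ U = Z ∩ O) ∧ Z ⊆ @closure α t U

/-- The product `p ⋆ q` of points is defined: some coordinate `a_i b_i` is nonzero. -/
def StarDefined {n : ℕ} (p q : PSpace n) : Prop := ∃ i, p.rep i * q.rep i ≠ 0

/-- The Hadamard product `p ⋆ q = [a_0 b_0 : … : a_n b_n]` of two points of `ℙⁿ`. -/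
def star {n : ℕ} (p q : PSpace n) (h : StarDefined p q) : PSpace n :=
  Projectivization.mk ℂ (fun i => p.rep i * q.rep i)
    (fun h0 => h.elim fun i hi => hi (congrFun h0 i))

/-- `p ⋆ A`, the set of all products `p ⋆ a` that are defined, `a ∈ A`. -/
def pointStar {n : ℕ} (p : PSpace n) (A : Set (PSpace n)) : Set (PSpace n) :=
  {s | ∃ a ∈ A, ∃ h : StarDefined p a, s = star p a h}

/-- The Hadamard product `X ⋆ Y`: the Zariski closure of the set of all `p ⋆ q` that are defined,
`p ∈ X`, `q ∈ Y`. -/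
def starVar {n : ℕ} (X Y : Set (PSpace n)) : Set (PSpace n) :=
  @closure (PSpace n) (zariski n) {s | ∃ p ∈ X, ∃ q ∈ Y, ∃ h : StarDefined p q, s = star p q h}

/-- The point `[1 : … : 1]`. -/
def onePoint (n : ℕ) : PSpace n :=
  Projectivization.mk ℂ (fun _ => 1) (fun h0 => one_ne_zero (congrFun h0 (0 : Fin (n + 1))))

/-- The Hadamard powers: `X^{⋆0} = {[1 : … : 1]}` and `X^{⋆(r+1)} = X ⋆ X^{⋆r}`. -/
def starPow {n : ℕ} (X : Set (PSpace n)) : ℕ → Set (PSpace n)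
  | 0 => {onePoint n}
  | r + 1 => starVar X (starPow X r)

/-- The product of the points `p i`, `i ∈ s`, is defined: some coordinate of it is nonzero. -/
def ProdDefined {ι : Type} {n : ℕ} (s : Finset ι) (p : ι → PSpace n) : Prop :=
  ∃ j, ∏ i ∈ s, (p i).rep j ≠ 0

/-- The Hadamard product of the points `p i`, `i ∈ s` (it is `[1 : … : 1]` for `s = ∅`). -/
def starProd {ι : Type} {n : ℕ} (s : Finset ι) (p : ι → PSpace n) (h : ProdDefined s p) :
    PSpace n :=
  Projectivization.mk ℂ (fun j => ∏ i ∈ s, (p i).rep j)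
    (fun h0 => h.elim fun j hj => hj (congrFun h0 j))

theorem ProdDefined.mono {ι : Type} {n : ℕ} {s t : Finset ι} {p : ι → PSpace n}
    (h : ProdDefined t p) (hst : s ⊆ t) : ProdDefined s p := by
  obtain ⟨j, hj⟩ := h
  exact ⟨j, Finset.prod_ne_zero_iff.2 fun i hi => Finset.prod_ne_zero_iff.1 hj i (hst hi)⟩

/-- The linear space underlying the embedded tangent space of `X ⊆ ℙⁿ` at `p`: all `v ∈ ℂⁿ⁺¹` with
`∑ i, (∂f/∂x_i)(p) v_i = 0` for every homogeneous polynomial `f` vanishing on `X`. -/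
def tangentCone {n : ℕ} (X : Set (PSpace n)) (p : PSpace n) : Submodule ℂ (Fin (n + 1) → ℂ) where
  carrier := {v | ∀ (f : MvPolynomial (Fin (n + 1)) ℂ) (d : ℕ), f.IsHomogeneous d →
    (∀ x ∈ X, MvPolynomial.eval x.rep f = 0) →
    ∑ i, MvPolynomial.eval p.rep (MvPolynomial.pderiv i f) * v i = 0}
  zero_mem' := by
    intro f d _ _
    simp
  add_mem' := by
    intro v w hv hw f d hf hX
    have h1 := hv f d hf hX
    have h2 := hw f d hf hX
    simp only [Pi.add_apply, mul_add, Finset.sum_add_distrib, h1, h2, add_zero]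
  smul_mem' := by
    intro c v hv f d hf hX
    have h1 := hv f d hf hX
    simp only [Pi.smul_apply, smul_eq_mul, mul_left_comm _ c, ← Finset.mul_sum, h1, mul_zero]

/-- The (embedded, projective) tangent space `T_p(X)`, a linear subspace of `ℙⁿ`. -/
def tangentSpace {n : ℕ} (X : Set (PSpace n)) (p : PSpace n) :
    Projectivization.Subspace ℂ (Fin (n + 1) → ℂ) :=
  Submodule.projectivization (tangentCone X p)

end HadamardTerracini

end

namespace HadamardTerracini

/-! The Hadamard product comes from the polynomial map `hadamard` on multicones, whose `j`-th
component is the product over `i` of the variables `(i, j)`. By the product rule its differential at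
`p` sends `(w_i)` to the sum over `i` of `w_i` times the coordinates of all `p_k`, `k ≠ i`. The span
in the theorem is therefore the image of the tangent spaces of the factors. It always lies in the
tangent space of the product (`prod_erase_mul_mem_tangentCone`). The converse is generic smoothness
in characteristic zero: at a general point of an irreducible source, the differential is onto the
tangent space of the closure of the image.

Generic smoothness is proved algebraically. Let `K` be the function field of the source. A tangent
vector to the image at the generic point is a homomorphism from the coordinate ring of the image
closure to the dual numbers over `K`. As `K` is formally smooth over that ring, the homomorphism
extends to `K`, and the extension is a tangent vector of the source (`exists_tangent_lift`).
Choosing lifts linearly and clearing denominators gives polynomial matrices, which specialise to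
every point where the denominator is nonzero (`exists_generic_tangent_lift`).
`exists_isOpen_tangentCone_decomposition` carries this over to multiprojective space.

In general the product of the varieties is a finite union of irreducible closed sets `Z a`; let `W
a` be the closure of the image of `Z a`. `U` omits the bad locus of each `Z a`, and `V` omits the
points common to two distinct `W a`, so that a single `W a` determines the tangent space
(`tangentCone_le_of_subset_union`). If all factors are irreducible there is only one `W a`, and `V`
is everything. The two parts of the theorem are `terracini` for `Fin 2` and `Fin r`. -/

open MvPolynomial

/-! ### Directional derivatives and generic smoothness -/

/-- The derivative of `f` at `x` in the direction `w`. -/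
noncomputable def dirDeriv {σ K : Type*} [Fintype σ] [CommRing K] [Algebra ℂ K] (x w : σ → K)
    (f : MvPolynomial σ ℂ) : K :=
  ∑ k, aeval x (pderiv k f) * w k

section dirDeriv

variable {σ τ K : Type*} [Fintype σ] [Fintype τ] [CommRing K] [Algebra ℂ K]

theorem dirDeriv_add (x w : σ → K) (f g : MvPolynomial σ ℂ) :
    dirDeriv x w (f + g) = dirDeriv x w f + dirDeriv x w g := by
  simp [dirDeriv, add_mul, Finset.sum_add_distrib]

theorem dirDeriv_mul (x w : σ → K) (f g : MvPolynomial σ ℂ) :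
    dirDeriv x w (f * g) = aeval x f * dirDeriv x w g + aeval x g * dirDeriv x w f := by
  simp only [dirDeriv, Derivation.leibniz, smul_eq_mul, map_add, map_mul, Finset.mul_sum,
    ← Finset.sum_add_distrib]
  exact Finset.sum_congr rfl fun k _ => by ring

theorem dirDeriv_C (x w : σ → K) (c : ℂ) : dirDeriv x w (C c) = 0 := by
  simp [dirDeriv]

theorem dirDeriv_X (x w : σ → K) (i : σ) : dirDeriv x w (X i) = w i := by
  classical
  simp [dirDeriv, pderiv_X, Pi.single_apply, apply_ite, ite_mul]

theorem dirDeriv_sum {α : Type*} (x w : σ → K) (s : Finset α) (f : α → MvPolynomial σ ℂ) :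
    dirDeriv x w (∑ i ∈ s, f i) = ∑ i ∈ s, dirDeriv x w (f i) := by
  simp only [dirDeriv, map_sum, Finset.sum_mul]
  exact Finset.sum_comm

theorem dirDeriv_prod {α : Type*} [DecidableEq α] (x w : σ → K) (s : Finset α)
    (f : α → MvPolynomial σ ℂ) :
    dirDeriv x w (∏ i ∈ s, f i) =
      ∑ i ∈ s, (∏ j ∈ s.erase i, aeval x (f j)) * dirDeriv x w (f i) := by
  induction s using Finset.induction_on with
  | empty => simpa using dirDeriv_C x w 1
  | insert a s ha ih =>
    rw [Finset.prod_insert ha, dirDeriv_mul, ih, Finset.sum_insert ha, Finset.erase_insert ha,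
      map_prod, add_comm, Finset.mul_sum]
    congr 1
    refine Finset.sum_congr rfl fun i hi => ?_
    have hia : a ≠ i := fun h => ha (h ▸ hi)
    rw [Finset.erase_insert_of_ne hia, Finset.prod_insert (by simp [ha]), mul_assoc]

theorem dirDeriv_add_right (x w w' : σ → K) (f : MvPolynomial σ ℂ) :
    dirDeriv x (w + w') f = dirDeriv x w f + dirDeriv x w' f := by
  simp [dirDeriv, mul_add, Finset.sum_add_distrib]

theorem dirDeriv_smul_right (c : K) (x w : σ → K) (f : MvPolynomial σ ℂ) :
    dirDeriv x (c • w) f = c * dirDeriv x w f := by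
  simp [dirDeriv, mul_left_comm, Finset.mul_sum]

/-- The value of a polynomial on dual numbers records its directional derivative. -/
theorem aeval_inl_add_inr (x w : σ → K) (f : MvPolynomial σ ℂ) :
    aeval (fun k => (TrivSqZeroExt.inl (x k) + TrivSqZeroExt.inr (w k) : TrivSqZeroExt K K)) f =
      TrivSqZeroExt.inl (aeval x f) + TrivSqZeroExt.inr (dirDeriv x w f) := by
  induction f using MvPolynomial.induction_on with
  | C a =>
    rw [dirDeriv_C]
    ext <;> simp [TrivSqZeroExt.algebraMap_eq_inl']
  | add p q hp hq =>
    rw [map_add, hp, hq, dirDeriv_add]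
    ext <;> simp
  | mul_X p i hp =>
    rw [map_mul, hp, dirDeriv_mul, dirDeriv_X]
    ext <;> simp [mul_comm, add_comm]

/-- The chain rule. -/
theorem dirDeriv_aeval (x w : σ → K) (φ : τ → MvPolynomial σ ℂ) (h : MvPolynomial τ ℂ) :
    dirDeriv x w (aeval φ h) =
      dirDeriv (fun j => aeval x (φ j)) (fun j => dirDeriv x w (φ j)) h := by
  have h1 := aeval_inl_add_inr x w (aeval φ h)
  rw [← AlgHom.comp_apply, comp_aeval] at h1
  simp only [aeval_inl_add_inr] at h1
  simpa using (congrArg TrivSqZeroExt.snd h1).symm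

end dirDeriv

/-- Generic smoothness in characteristic zero: a homomorphism from a finitely generated subalgebra
of a field to an infinitesimal thickening of the field extends to the whole field. -/
theorem exists_lift_of_isNilpotent_ker {τ K C : Type*} [Finite τ] [Field K] [Algebra ℂ K]
    [Algebra.EssFiniteType ℂ K] [CommRing C] [Algebra ℂ C] (π : C →ₐ[ℂ] K)
    (hπ : Function.Surjective π) (hker : IsNilpotent (RingHom.ker π)) (y : τ → K) (c : τ → C)
    (hc : ∀ j, π (c j) = y j) (hv : ∀ h : MvPolynomial τ ℂ, aeval y h = 0 → aeval c h = 0) :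
    ∃ s : K →ₐ[ℂ] C, (∀ a, π (s a) = a) ∧ ∀ j, s (y j) = c j := by
  -- `Q` is the ideal of relations among the `y j`, so `B` is the subalgebra they generate; `hv`
  -- says exactly that `c` defines a map on `B`.
  let Q : Ideal (MvPolynomial τ ℂ) := RingHom.ker (aeval (R := ℂ) y)
  let B := MvPolynomial τ ℂ ⧸ Q
  have hQ : Q.IsPrime := RingHom.ker_isPrime _
  let ψ : B →ₐ[ℂ] K := Ideal.Quotient.liftₐ Q (aeval y) fun a ha => ha
  let ρ : B →ₐ[ℂ] C := Ideal.Quotient.liftₐ Q (aeval c) fun a ha => hv a ha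
  have hψ : Function.Injective ψ := by
    rw [injective_iff_map_eq_zero]
    intro b hb
    obtain ⟨f, rfl⟩ := Ideal.Quotient.mk_surjective b
    exact Ideal.Quotient.eq_zero_iff_mem.2 hb
  let : Algebra B K := ψ.toRingHom.toAlgebra
  let : Algebra B C := ρ.toRingHom.toAlgebra
  have hfs : FaithfulSMul B K := (faithfulSMul_iff_algebraMap_injective B K).2 hψ
  have : IsScalarTower ℂ B K := IsScalarTower.of_algebraMap_eq fun c => (ψ.commutes c).symm
  have : IsScalarTower ℂ B C := IsScalarTower.of_algebraMap_eq fun c => (ρ.commutes c).symm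
  let : Algebra (FractionRing B) K := FractionRing.liftAlgebra B K
  have : IsScalarTower B (FractionRing B) K := FractionRing.isScalarTower_liftAlgebra B K
  have : IsScalarTower ℂ (FractionRing B) K := by
    refine IsScalarTower.of_algebraMap_eq fun c => ?_
    rw [IsScalarTower.algebraMap_apply ℂ B K, IsScalarTower.algebraMap_apply ℂ B (FractionRing B),
      ← IsScalarTower.algebraMap_apply B (FractionRing B) K]
  -- Formal smoothness of `K` over `B` is obtained in two stages: a localization is formally smooth,
  -- and so is an essentially finitely generated field extension in characteristic zero.
  have : Algebra.EssFiniteType (FractionRing B) K := Algebra.EssFiniteType.of_comp ℂ _ K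
  have : CharZero (FractionRing B) :=
    charZero_of_injective_algebraMap (algebraMap ℂ (FractionRing B)).injective
  have : Algebra.FormallySmooth B (FractionRing B) :=
    Algebra.FormallySmooth.of_isLocalization (nonZeroDivisors B)
  have : Algebra.FormallySmooth B K := Algebra.FormallySmooth.comp B (FractionRing B) K
  have hρ : ∀ b : B, π (ρ b) = ψ b := by
    intro b
    obtain ⟨f, rfl⟩ := Ideal.Quotient.mk_surjective b
    change π (aeval c f) = aeval y f
    rw [← AlgHom.comp_apply, comp_aeval]
    simp only [hc]
  let g : C →ₐ[B] K := { π.toRingHom with commutes' := hρ }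
  let s := Algebra.FormallySmooth.liftOfSurjective (AlgHom.id B K) g hπ hker
  refine ⟨s.restrictScalars ℂ, fun a => ?_, fun j => ?_⟩
  · exact Algebra.FormallySmooth.liftOfSurjective_apply (AlgHom.id B K) g hπ hker a
  · have h1 : y j = algebraMap B K (Ideal.Quotient.mk Q (X j)) := by
      change y j = aeval y (X j)
      simp
    have h2 := s.commutes (Ideal.Quotient.mk Q (X j))
    rw [← h1] at h2
    refine Eq.trans h2 ?_
    change aeval _ (X j) = _
    simp

/-- In characteristic zero, a tangent vector at the generic point of the image lifts to a ring
homomorphism to the dual numbers. -/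
theorem exists_lift_dual {τ K : Type*} [Fintype τ] [Field K] [Algebra ℂ K]
    [Algebra.EssFiniteType ℂ K] (y v : τ → K)
    (hv : ∀ h : MvPolynomial τ ℂ, aeval y h = 0 → dirDeriv y v h = 0) :
    ∃ s : K →ₐ[ℂ] TrivSqZeroExt K K, (∀ a, (s a).fst = a) ∧
      ∀ j, s (y j) = TrivSqZeroExt.inl (y j) + TrivSqZeroExt.inr (v j) := by
  refine exists_lift_of_isNilpotent_ker (TrivSqZeroExt.fstHom ℂ K K)
    (fun a => ⟨TrivSqZeroExt.inl a, rfl⟩) ⟨2, ?_⟩ y _ (fun j => by simp) fun h hh => ?_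
  -- The kernel consists of the infinitesimal parts, whose pairwise products vanish.
  · rw [Submodule.pow_succ, Submodule.pow_one, Ideal.zero_eq_bot, eq_bot_iff, Ideal.mul_le]
    intro a ha b hb
    have ha' : a.fst = 0 := ha
    have hb' : b.fst = 0 := hb
    rw [Ideal.mem_bot]
    ext <;> simp [ha', hb']
  · rw [aeval_inl_add_inr, hv h hh, hh]
    simp

/-- In characteristic zero, the differential of a dominant map is surjective on tangent vectors
at the generic point. -/
theorem exists_tangent_lift {σ τ K : Type*} [Fintype σ] [Fintype τ] [Field K] [Algebra ℂ K]
    [Algebra.EssFiniteType ℂ K] (x : σ → K) (φ : τ → MvPolynomial σ ℂ) (v : τ → K)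
    (hv : ∀ h : MvPolynomial τ ℂ, aeval x (aeval φ h) = 0 →
      dirDeriv (fun j => aeval x (φ j)) v h = 0) :
    ∃ w : σ → K, (∀ f, aeval x f = 0 → dirDeriv x w f = 0) ∧ ∀ j, dirDeriv x w (φ j) = v j := by
  obtain ⟨s, hs, hsv⟩ := exists_lift_dual (fun j => aeval x (φ j)) v fun h hh => hv h (by
    rwa [← AlgHom.comp_apply, comp_aeval])
  have key : ∀ f : MvPolynomial σ ℂ, s (aeval x f) = TrivSqZeroExt.inl (aeval x f) +
      TrivSqZeroExt.inr (dirDeriv x (fun k => (s (x k)).snd) f) := by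
    intro f
    rw [← aeval_inl_add_inr, ← AlgHom.comp_apply, comp_aeval]
    congr 2
    funext k
    ext <;> simp [hs]
  -- The infinitesimal part of `s` is a derivation of `K`; its values on the coordinates form the
  -- tangent vector.
  refine ⟨fun k => (s (x k)).snd, fun f hf => ?_, fun j => ?_⟩
  · have := congrArg TrivSqZeroExt.snd (key f)
    simpa [hf] using this.symm
  · have := congrArg TrivSqZeroExt.snd ((key (φ j)).symm.trans (hsv j))
    simpa using this

/-- A map that covers the kernel of `M` extends to a splitting of the resulting exact sequence. -/
theorem exists_splitting {K E F G : Type*} [Field K] [AddCommGroup E] [Module K E]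
    [AddCommGroup F] [Module K F] [AddCommGroup G] [Module K G] (D : E →ₗ[K] F)
    (T : Submodule K E) (M : F →ₗ[K] G) (h : ∀ v, M v = 0 → ∃ w ∈ T, D w = v) :
    ∃ (A : F →ₗ[K] E) (B : G →ₗ[K] F), (∀ v, A v ∈ T) ∧ ∀ v, D (A v) + B (M v) = v := by
  obtain ⟨r, hr⟩ := M.rangeRestrict.exists_rightInverse_of_surjective M.range_rangeRestrict
  obtain ⟨B, hB⟩ := LinearMap.exists_extend r
  -- `B` inverts `M` on its range, so `v - B (M v)` lies in the kernel of `M` and can be lifted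
  -- linearly into `T`.
  have hM : ∀ v, M (v - B (M v)) = 0 := by
    intro v
    have h1 : B (M v) = r (M.rangeRestrict v) :=
      LinearMap.congr_fun hB (M.rangeRestrict v)
    have h2 := congrArg Subtype.val (LinearMap.congr_fun hr (M.rangeRestrict v))
    rw [map_sub, h1, sub_eq_zero]
    exact h2.symm
  let D' : T →ₗ[K] F := D ∘ₗ T.subtype
  obtain ⟨r', hr'⟩ := D'.rangeRestrict.exists_rightInverse_of_surjective D'.range_rangeRestrict
  let N : F →ₗ[K] LinearMap.range D' := LinearMap.codRestrict _ (LinearMap.id - B ∘ₗ M) fun v => by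
    obtain ⟨w, hw, hwv⟩ := h _ (hM v)
    exact ⟨⟨w, hw⟩, hwv⟩
  refine ⟨T.subtype ∘ₗ r' ∘ₗ N, B, fun v => (r' (N v)).2, fun v => ?_⟩
  have h3 := congrArg Subtype.val (LinearMap.congr_fun hr' (N v))
  have h4 : D (T.subtype (r' (N v))) = v - B (M v) := h3
  simp only [LinearMap.comp_apply, h4]
  abel

/-- Finitely many elements of the function field of a prime ideal have a common denominator. -/
theorem exists_common_denominator {σ α : Type*} [Finite α] (P : Ideal (MvPolynomial σ ℂ))
    [P.IsPrime] (a : α → FractionRing (MvPolynomial σ ℂ ⧸ P)) :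
    ∃ g ∉ P, ∃ c : α → MvPolynomial σ ℂ, ∀ i,
      algebraMap _ (FractionRing (MvPolynomial σ ℂ ⧸ P)) (Ideal.Quotient.mk P (c i)) =
        algebraMap _ (FractionRing (MvPolynomial σ ℂ ⧸ P)) (Ideal.Quotient.mk P g) * a i := by
  obtain ⟨b, hb⟩ := IsLocalization.exist_integer_multiples_of_finite
    (nonZeroDivisors (MvPolynomial σ ℂ ⧸ P)) a
  obtain ⟨g, hg⟩ := Ideal.Quotient.mk_surjective (b : MvPolynomial σ ℂ ⧸ P)
  choose d hd using hb
  choose c hc using fun i => Ideal.Quotient.mk_surjective (d i)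
  refine ⟨g, fun h => nonZeroDivisors.ne_zero b.2 ?_, c, fun i => ?_⟩
  · rw [← hg, Ideal.Quotient.eq_zero_iff_mem.2 h]
  · rw [hc, hd, hg, Algebra.smul_def]

theorem dirDeriv_eq_zero_of_mem_span {τ K : Type*} [Fintype τ] [CommRing K] [Algebra ℂ K]
    {y v : τ → K} {s : Set (MvPolynomial τ ℂ)} (hs : ∀ h ∈ s, aeval y h = 0)
    (hs' : ∀ h ∈ s, dirDeriv y v h = 0) {h : MvPolynomial τ ℂ} (hh : h ∈ Ideal.span s) :
    dirDeriv y v h = 0 := by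
  suffices aeval y h = 0 ∧ dirDeriv y v h = 0 from this.2
  induction hh using Submodule.span_induction with
  | mem h hmem => exact ⟨hs h hmem, hs' h hmem⟩
  | zero => simp [dirDeriv]
  | add a b _ _ iha ihb =>
    rw [map_add, dirDeriv_add, iha.1, iha.2, ihb.1, ihb.2]
    simp
  | smul a b _ ihb =>
    rw [smul_eq_mul, map_mul, dirDeriv_mul, ihb.1, ihb.2]
    simp

/-- A polynomial form, with denominators cleared, of the surjectivity of the differential at the
generic point: there is a matrix `c` whose columns are tangent to `P`, and whose image under the
Jacobian of `φ` is a nonzero multiple of the identity, up to the Jacobian of equations `s` of the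
image. -/
theorem exists_polynomial_tangent_lift {σ τ : Type*} [Fintype σ] [Fintype τ] [DecidableEq τ]
    (P : Ideal (MvPolynomial σ ℂ)) [P.IsPrime] (φ : τ → MvPolynomial σ ℂ) :
    ∃ g ∉ P, ∃ (s : Finset (MvPolynomial τ ℂ)) (c : σ → τ → MvPolynomial σ ℂ)
      (d : τ → s → MvPolynomial σ ℂ), (∀ h ∈ s, aeval φ h ∈ P) ∧
      (∀ j, ∀ f ∈ P, ∑ k, pderiv k f * c k j ∈ P) ∧
      ∀ j j', ∑ k, pderiv k (φ j') * c k j +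
        ∑ h : s, d j' h * aeval φ (pderiv j h.1) - (if j' = j then g else 0) ∈ P := by
  let K := FractionRing (MvPolynomial σ ℂ ⧸ P)
  let q : MvPolynomial σ ℂ →ₐ[ℂ] K :=
    (IsScalarTower.toAlgHom ℂ (MvPolynomial σ ℂ ⧸ P) K).comp (Ideal.Quotient.mkₐ ℂ P)
  have hq : ∀ f, q f = 0 ↔ f ∈ P := by
    intro f
    rw [← Ideal.Quotient.eq_zero_iff_mem]
    exact FaithfulSMul.algebraMap_eq_zero_iff (MvPolynomial σ ℂ ⧸ P) K
  let x : σ → K := fun k => q (X k)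
  have hx : ∀ f, aeval x f = q f := fun f => by
    rw [aeval_unique q]
    rfl
  have : Algebra.EssFiniteType (MvPolynomial σ ℂ ⧸ P) K :=
    Algebra.EssFiniteType.of_isLocalization K (nonZeroDivisors _)
  have : Algebra.EssFiniteType ℂ K := Algebra.EssFiniteType.comp ℂ (MvPolynomial σ ℂ ⧸ P) K
  let Q : Ideal (MvPolynomial τ ℂ) := P.comap (aeval φ)
  -- Finitely many equations of the image closure suffice, so tangency to it becomes the vanishing
  -- of one linear map `M`.
  obtain ⟨s, hs⟩ := (isNoetherianRing_iff_ideal_fg _).1 inferInstance Q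
  let y : τ → K := fun j => aeval x (φ j)
  let D : (σ → K) →ₗ[K] (τ → K) :=
    { toFun := fun w j => dirDeriv x w (φ j)
      map_add' := fun w w' => funext fun j => dirDeriv_add_right x w w' _
      map_smul' := fun c w => funext fun j => dirDeriv_smul_right c x w _ }
  let M : (τ → K) →ₗ[K] (s → K) :=
    { toFun := fun v h => dirDeriv y v h.1
      map_add' := fun w w' => funext fun j => dirDeriv_add_right y w w' _
      map_smul' := fun c w => funext fun j => dirDeriv_smul_right c y w _ }
  let T : Submodule K (σ → K) :=
    { carrier := {w | ∀ f ∈ P, dirDeriv x w f = 0}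
      add_mem' := fun hv hw f hf => by rw [dirDeriv_add_right, hv f hf, hw f hf, add_zero]
      zero_mem' := fun f hf => by simp [dirDeriv]
      smul_mem' := fun c w hw f hf => by rw [dirDeriv_smul_right, hw f hf, mul_zero] }
  have hyQ : ∀ h : MvPolynomial τ ℂ, aeval y h = q (aeval φ h) := by
    intro h
    rw [← hx, ← AlgHom.comp_apply, comp_aeval]
  obtain ⟨A, B, hA, hAB⟩ := exists_splitting D T M fun v hv => by
    obtain ⟨w, hw, hw'⟩ := exists_tangent_lift x φ v fun h hh => by
      rw [hx, hq] at hh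
      have hmem : h ∈ Ideal.span (s : Set (MvPolynomial τ ℂ)) := hs ▸ hh
      refine dirDeriv_eq_zero_of_mem_span (fun h hh => ?_) (fun h hh => ?_) hmem
      · exact (hyQ h).trans ((hq _).2 (hs.le (Ideal.subset_span hh)))
      · exact congrFun hv ⟨h, hh⟩
    exact ⟨w, fun f hf => hw f (by rwa [hx, hq]), funext hw'⟩
  -- One denominator serves for all matrix entries of `A` and `B`; the identity `D A + B M = 1` over
  -- `K` becomes a congruence modulo `P` after multiplication by `g`.
  obtain ⟨g, hg, c, hc⟩ := exists_common_denominator P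
    (Sum.elim (fun p : σ × τ => A (Pi.single p.2 1) p.1)
      (fun p : τ × s => B (Pi.single p.2 1) p.1))
  have hcA : ∀ k j, q (c (.inl (k, j))) = q g * A (Pi.single j 1) k := fun k j => hc (.inl (k, j))
  have hcB : ∀ j h, q (c (.inr (j, h))) = q g * B (Pi.single h 1) j := fun j h => hc (.inr (j, h))
  refine ⟨g, hg, s, fun k j => c (.inl (k, j)), fun j h => c (.inr (j, h)),
    fun h hh => hs.le (Ideal.subset_span hh), ?_, ?_⟩
  · intro j f hf
    rw [← hq, map_sum]
    have := hA (Pi.single j 1) f hf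
    simp only [dirDeriv, hx] at this
    simp only [map_mul, hcA, mul_left_comm _ (q g)]
    rw [← Finset.mul_sum, this, mul_zero]
  · intro j j'
    have h1 := congrFun (hAB (Pi.single j 1)) j'
    have h2 : M (Pi.single j 1) = ∑ h : s, aeval y (pderiv j h.1) • Pi.single h 1 := by
      ext h
      simp [M, dirDeriv, Pi.single_apply]
    rw [h2, map_sum] at h1
    simp only [map_smul, Pi.add_apply, Finset.sum_apply, Pi.smul_apply, smul_eq_mul, hyQ] at h1
    have h3 : D (A (Pi.single j 1)) j' = ∑ k, q (pderiv k (φ j')) * A (Pi.single j 1) k :=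
      Finset.sum_congr rfl fun k _ => by rw [hx]
    rw [h3] at h1
    rw [← hq, map_sub, map_add, map_sum, map_sum, sub_eq_zero]
    simp only [map_mul, hcA, hcB]
    have h4 : q (if j' = j then g else 0) = q g * (Pi.single j 1 : τ → K) j' := by
      by_cases h : j' = j <;> simp [h]
    rw [h4, ← h1, mul_add, Finset.mul_sum, Finset.mul_sum]
    refine congrArg₂ (· + ·) ?_ ?_
    · exact Finset.sum_congr rfl fun k _ => mul_left_comm _ _ _
    · exact Finset.sum_congr rfl fun k _ => (mul_assoc _ _ _).trans (congrArg _ (mul_comm _ _))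

/-- Over a general point of an irreducible affine variety, every tangent vector of the closure of
its image under a polynomial map is the image of a tangent vector. -/
theorem exists_generic_tangent_lift {σ τ : Type*} [Fintype σ] [Fintype τ]
    (P : Ideal (MvPolynomial σ ℂ)) [P.IsPrime] (φ : τ → MvPolynomial σ ℂ) :
    ∃ g ∉ P, ∀ z : σ → ℂ, (∀ f ∈ P, aeval z f = 0) → aeval z g ≠ 0 → ∀ v : τ → ℂ,
      (∀ h : MvPolynomial τ ℂ, aeval φ h ∈ P → dirDeriv (fun j => aeval z (φ j)) v h = 0) →
      ∃ w : σ → ℂ, (∀ f ∈ P, dirDeriv z w f = 0) ∧ ∀ j, dirDeriv z w (φ j) = v j := by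
  classical
  obtain ⟨g, hg, s, c, d, hs, hT, hS⟩ := exists_polynomial_tangent_lift P φ
  refine ⟨g, hg, fun z hz hgz v hv => ?_⟩
  -- The lift is the specialised matrix `c` applied to `v`, divided by `g`; the correction term in
  -- `d` disappears because `v` is killed by the Jacobian of `s`.
  refine ⟨fun k => (aeval z g)⁻¹ * ∑ j, aeval z (c k j) * v j, fun f hf => ?_,
    fun j' => ?_⟩
  · have h1 : ∀ j, ∑ k, aeval z (pderiv k f) * aeval z (c k j) = 0 := fun j => by
      simpa using hz _ (hT j f hf)
    calc _ = (aeval z g)⁻¹ * ∑ j, (∑ k, aeval z (pderiv k f) * aeval z (c k j)) * v j := by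
          simp only [dirDeriv, Finset.sum_mul, Finset.mul_sum]
          rw [Finset.sum_comm]
          exact Finset.sum_congr rfl fun j _ => Finset.sum_congr rfl fun k _ => by ring
      _ = 0 := by simp only [h1, zero_mul, Finset.sum_const_zero, mul_zero]
  · have h1 : ∀ j, ∑ k, aeval z (pderiv k (φ j')) * aeval z (c k j) =
        (if j' = j then aeval z g else 0) -
        ∑ h : s, aeval z (d j' h) * aeval z (aeval φ (pderiv j h.1)) := fun j => by
      have := hz _ (hS j j')
      rw [map_sub, map_add, map_sum, map_sum] at this
      simp only [map_mul, apply_ite (aeval z), map_zero] at this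
      linear_combination this
    have h2 : ∀ h : s, ∑ j, aeval z (aeval φ (pderiv j h.1)) * v j = 0 := fun h => by
      have := hv h.1 (hs _ h.2)
      simp only [dirDeriv] at this
      rw [← this]
      refine Finset.sum_congr rfl fun j _ => ?_
      rw [← AlgHom.comp_apply, comp_aeval]
    calc _ = (aeval z g)⁻¹ *
          ∑ j, (∑ k, aeval z (pderiv k (φ j')) * aeval z (c k j)) * v j := by
          simp only [dirDeriv, Finset.sum_mul, Finset.mul_sum]
          rw [Finset.sum_comm]
          exact Finset.sum_congr rfl fun j _ => Finset.sum_congr rfl fun k _ => by ring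
      _ = (aeval z g)⁻¹ * (aeval z g * v j' -
          ∑ h : s, aeval z (d j' h) * ∑ j, aeval z (aeval φ (pderiv j h.1)) * v j) := by
          simp only [h1, sub_mul, Finset.sum_sub_distrib, ite_mul, zero_mul, Finset.sum_ite_eq,
            Finset.mem_univ, if_true, Finset.sum_mul, Finset.mul_sum]
          rw [Finset.sum_comm]
          simp only [mul_assoc]
      _ = v j' := by
          simp only [h2, mul_zero, Finset.sum_const_zero, sub_zero]
          exact inv_mul_cancel_left₀ hgz _

/-! ### Homogeneous components and torus scaling -/

section homogeneous

theorem eval_mul_eq_of_support {σ : Type*} [Fintype σ] {f : MvPolynomial σ ℂ} {t : σ → ℂ} {c : ℂ}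
    (h : ∀ m ∈ f.support, ∏ k, t k ^ m k = c) (z : σ → ℂ) :
    eval (fun k => t k * z k) f = c * eval z f := by
  rw [eval_eq', eval_eq', Finset.mul_sum]
  refine Finset.sum_congr rfl fun m hm => ?_
  simp only [mul_pow, Finset.prod_mul_distrib, h m hm]
  ring

theorem eval_smul_of_isHomogeneous {σ : Type*} [Fintype σ] {f : MvPolynomial σ ℂ} {d : ℕ}
    (hf : f.IsHomogeneous d) (t : ℂ) (z : σ → ℂ) : eval (t • z) f = t ^ d * eval z f := by
  refine eval_mul_eq_of_support (t := fun _ => t) (fun m hm => ?_) z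
  rw [Finset.prod_pow_eq_pow_sum, hf.degree_eq_sum_deg_support hm]
  exact congrArg (t ^ ·) (Finset.sum_subset (Finset.subset_univ _) (by simp)).symm

/-- A nonzero polynomial does not vanish on the torus. -/
theorem eq_zero_of_eval_torus {ι : Type*} {F : MvPolynomial ι ℂ}
    (h : ∀ t : ι → ℂ, (∀ i, t i ≠ 0) → eval t F = 0) : F = 0 := by
  refine funext_set (fun _ => {0}ᶜ) (fun _ => (Set.finite_singleton 0).infinite_compl) ?_
  intro t ht
  rw [map_zero]
  exact h t fun i => ht i (Set.mem_univ i)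

variable {ι : Type} [DecidableEq ι] [Fintype ι] {n : ℕ}

theorem eval_mul_of_isMultihomogeneous {f : MvPolynomial (ι × Fin (n + 1)) ℂ} {d : ι → ℕ}
    (hf : IsMultihomogeneous f d) (t : ι → ℂ) (z : ι × Fin (n + 1) → ℂ) :
    eval (fun k => t k.1 * z k) f = (∏ i, t i ^ d i) * eval z f := by
  refine eval_mul_eq_of_support (t := fun k : ι × Fin (n + 1) => t k.1) (fun m hm => ?_) z
  have h1 : Finsupp.weight (fun k : ι × Fin (n + 1) => (Pi.single k.1 1 : ι → ℕ)) m = d :=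
    hf (mem_support_iff.1 hm)
  have h2 : ∀ i, d i = ∑ k, m k * (Pi.single k.1 1 : ι → ℕ) i := by
    intro i
    rw [← h1, Finsupp.weight_apply, Finsupp.sum_fintype _ _ (by simp)]
    simp
  simp only [h2, ← Finset.prod_pow_eq_pow_sum]
  rw [Finset.prod_comm]
  refine Finset.prod_congr rfl fun k _ => ?_
  rw [Finset.prod_eq_single k.1]
  · simp
  · intro i _ hi
    simp [hi]
  · simp

theorem eval_homogeneousComponent_eq_zero {σ : Type*} [Fintype σ] {f : MvPolynomial σ ℂ} {z : σ → ℂ}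
    (h : ∀ t : ℂ, t ≠ 0 → eval (t • z) f = 0) (d : ℕ) : eval z (homogeneousComponent d f) = 0 := by
  -- As a function of `t`, the value at `t • z` is a polynomial whose coefficients are the values of
  -- the components at `z`; it has infinitely many roots.
  let p : Polynomial ℂ := ∑ i ∈ Finset.range (f.totalDegree + 1),
    Polynomial.monomial i (eval z (homogeneousComponent i f))
  have hp : p = 0 := by
    refine Polynomial.eq_zero_of_infinite_isRoot p (Set.Infinite.mono (s := {0}ᶜ) ?_
      (Set.finite_singleton 0).infinite_compl)
    intro t ht
    have h1 := h t ht
    rw [← sum_homogeneousComponent f, map_sum] at h1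
    simp only [eval_smul_of_isHomogeneous (homogeneousComponent_isHomogeneous _ f)] at h1
    simp only [Set.mem_ofPred_eq, Polynomial.IsRoot.def, p, Polynomial.eval_finsetSum,
      Polynomial.eval_monomial]
    rw [← h1]
    exact Finset.sum_congr rfl fun i _ => mul_comm _ _
  by_cases hd : d < f.totalDegree + 1
  · have := congrArg (Polynomial.coeff · d) hp
    simpa [p, Polynomial.finsetSum_coeff, Polynomial.coeff_monomial, hd] using this
  · rw [homogeneousComponent_eq_zero _ _ (by omega), map_zero]

theorem eval_weightedHomogeneousComponent_eq_zero {f : MvPolynomial (ι × Fin (n + 1)) ℂ}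
    {z : ι × Fin (n + 1) → ℂ}
    (h : ∀ t : ι → ℂ, (∀ i, t i ≠ 0) → eval (fun k => t k.1 * z k) f = 0) (d : ι → ℕ) :
    eval z (weightedHomogeneousComponent
      (fun k : ι × Fin (n + 1) => (Pi.single k.1 1 : ι → ℕ)) d f) = 0 := by
  set w := fun k : ι × Fin (n + 1) => (Pi.single k.1 1 : ι → ℕ)
  have hfin := weightedHomogeneousComponent_finsupp (w := w) f
  -- The same argument with one scaling variable per factor: the monomial with exponent `d` has as
  -- coefficient the value of the component of multidegree `d`.
  let F : MvPolynomial ι ℂ := ∑ d ∈ hfin.toFinset,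
    monomial (Finsupp.equivFunOnFinite.symm d) (eval z (weightedHomogeneousComponent w d f))
  have hF : F = 0 := by
    refine eq_zero_of_eval_torus fun t ht => ?_
    have h1 := h t ht
    rw [← finsum_weightedHomogeneousComponent w f, finsum_eq_sum _ hfin, map_sum] at h1
    rw [← h1, map_sum]
    refine Finset.sum_congr rfl fun d _ => ?_
    rw [eval_mul_of_isMultihomogeneous
      (weightedHomogeneousComponent_isWeightedHomogeneous (w := w) d f), eval_monomial,
      Finsupp.prod_fintype _ _ (by simp), mul_comm]
    rfl
  by_cases hd : weightedHomogeneousComponent w d f = 0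
  · rw [hd, map_zero]
  · have h2 := congrArg (coeff (Finsupp.equivFunOnFinite.symm d)) hF
    have h3 : d ∈ hfin.toFinset := hfin.mem_toFinset.2 hd
    simpa [F, coeff_sum, coeff_monomial, -Set.Finite.mem_toFinset, h3] using h2

theorem sum_weightedHomogeneousComponent_eval_eq_zero {f : MvPolynomial (ι × Fin (n + 1)) ℂ}
    {z : ι × Fin (n + 1) → ℂ}
    (h : ∀ d, eval z (weightedHomogeneousComponent
      (fun k : ι × Fin (n + 1) => (Pi.single k.1 1 : ι → ℕ)) d f) = 0) (t : ι → ℂ) :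
    eval (fun k => t k.1 * z k) f = 0 := by
  set w := fun k : ι × Fin (n + 1) => (Pi.single k.1 1 : ι → ℕ)
  rw [← finsum_weightedHomogeneousComponent w f,
    finsum_eq_sum _ (weightedHomogeneousComponent_finsupp (w := w) f), map_sum]
  refine Finset.sum_eq_zero fun d _ => ?_
  rw [eval_mul_of_isMultihomogeneous
      (weightedHomogeneousComponent_isWeightedHomogeneous (w := w) d f), h, mul_zero]

end homogeneous

/-! ### The Zariski topologies -/

section topology

variable {n : ℕ}

theorem isClosed_zariski_iff {Z : Set (PSpace n)} : IsClosed[zariski n] Z ↔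
    ∃ S : Set (MvPolynomial (Fin (n + 1)) ℂ),
      (∀ f ∈ S, ∃ d : ℕ, f.IsHomogeneous d) ∧ Z = zeroLocus S := by
  rw [← @isOpen_compl_iff _ _ (zariski n)]
  change Zᶜᶜ ∈ _ ↔ _
  rw [compl_compl]
  rfl

theorem isClosed_multiZariski_iff {ι : Type} [DecidableEq ι] {Z : Set (ι → PSpace n)} :
    IsClosed[multiZariski ι n] Z ↔ ∃ S : Set (MvPolynomial (ι × Fin (n + 1)) ℂ),
      (∀ f ∈ S, ∃ d : ι → ℕ, IsMultihomogeneous f d) ∧ Z = multiZeroLocus S := by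
  rw [← @isOpen_compl_iff _ _ (multiZariski ι n)]
  change Zᶜᶜ ∈ _ ↔ _
  rw [compl_compl]
  rfl

theorem isClosed_eval_eq_zero {f : MvPolynomial (Fin (n + 1)) ℂ} {d : ℕ} (hf : f.IsHomogeneous d) :
    IsClosed[zariski n] {p : PSpace n | eval p.rep f = 0} :=
  isClosed_zariski_iff.2 ⟨{f}, by rintro _ rfl; exact ⟨d, hf⟩, by simp [zeroLocus]⟩

theorem exists_eval_ne_zero_of_notMem {Z : Set (PSpace n)} (hZ : IsClosed[zariski n] Z)
    {w : PSpace n} (hw : w ∉ Z) : ∃ (f : MvPolynomial (Fin (n + 1)) ℂ) (d : ℕ), f.IsHomogeneous d ∧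
      (∀ x ∈ Z, eval x.rep f = 0) ∧ eval w.rep f ≠ 0 := by
  obtain ⟨S, hS, rfl⟩ := isClosed_zariski_iff.1 hZ
  simp only [zeroLocus, Set.mem_ofPred_eq, not_forall] at hw
  obtain ⟨f, hf, hfw⟩ := hw
  obtain ⟨d, hd⟩ := hS f hf
  exact ⟨f, d, hd, fun x hx => hx f hf, hfw⟩

/-- The vectors of homogeneous coordinates of a point of a product of projective spaces, scaled
by `t`. -/
noncomputable def coords {ι : Type} (t : ι → ℂ) (p : ι → PSpace n) : ι × Fin (n + 1) → ℂ :=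
  fun k => t k.1 * (p k.1).rep k.2

/-- Vanishing along a whole punctured line means vanishing of every homogeneous component. Thus
arbitrary polynomials define closed sets, and pullbacks need not be checked for homogeneity. -/
theorem isClosed_forall_eval_smul (f : MvPolynomial (Fin (n + 1)) ℂ) :
    IsClosed[zariski n] {p : PSpace n | ∀ t : ℂ, t ≠ 0 → eval (t • p.rep) f = 0} := by
  refine isClosed_zariski_iff.2 ⟨Set.range fun d => homogeneousComponent d f, ?_, ?_⟩
  · rintro _ ⟨d, rfl⟩
    exact ⟨d, homogeneousComponent_isHomogeneous d f⟩
  · ext p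
    simp only [zeroLocus, Set.mem_ofPred_eq, Set.forall_mem_range]
    refine ⟨eval_homogeneousComponent_eq_zero, fun h t _ => ?_⟩
    rw [← sum_homogeneousComponent f, map_sum]
    refine Finset.sum_eq_zero fun d _ => ?_
    rw [eval_smul_of_isHomogeneous (homogeneousComponent_isHomogeneous d f), h, mul_zero]

variable {ι : Type} [DecidableEq ι] [Fintype ι]

theorem isClosed_forall_eval_coords (f : MvPolynomial (ι × Fin (n + 1)) ℂ) :
    IsClosed[multiZariski ι n]
      {p : ι → PSpace n | ∀ t : ι → ℂ, (∀ i, t i ≠ 0) → eval (coords t p) f = 0} := by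
  refine isClosed_multiZariski_iff.2 ⟨Set.range fun d => weightedHomogeneousComponent
      (fun k : ι × Fin (n + 1) => (Pi.single k.1 1 : ι → ℕ)) d f, ?_, ?_⟩
  · rintro _ ⟨d, rfl⟩
    exact ⟨d, weightedHomogeneousComponent_isWeightedHomogeneous d f⟩
  · ext p
    simp only [multiZeroLocus, Set.mem_ofPred_eq, Set.forall_mem_range]
    exact ⟨eval_weightedHomogeneousComponent_eq_zero,
      fun h t _ => sum_weightedHomogeneousComponent_eval_eq_zero h t⟩

/-- A closed set is determined by its vanishing ideal, so descending chains of closed sets give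
ascending chains of ideals in a Noetherian ring. -/
theorem noetherianSpace_multiZariski :
    @TopologicalSpace.NoetherianSpace (ι → PSpace n) (multiZariski ι n) := by
  let _ := multiZariski ι n
  refine ((TopologicalSpace.noetherianSpace_TFAE (ι → PSpace n)).out 0 1 :).2 ?_
  let I : TopologicalSpace.Closeds (ι → PSpace n) → Ideal (MvPolynomial (ι × Fin (n + 1)) ℂ) :=
    fun Z => ⨅ p ∈ Z, RingHom.ker (eval fun k : ι × Fin (n + 1) => (p k.1).rep k.2)
  have hI : ∀ Z f, f ∈ I Z ↔ ∀ p ∈ Z, eval (fun k : ι × Fin (n + 1) => (p k.1).rep k.2) f = 0 := by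
    intro Z f
    simp only [I, Submodule.mem_iInf, RingHom.mem_ker]
  have hanti : StrictAnti I := by
    intro Z Z' h
    refine lt_of_le_not_ge (fun f hf => (hI _ _).2 fun p hp => (hI _ _).1 hf p (h.le hp)) ?_
    intro hle
    refine h.not_ge fun p hp => ?_
    obtain ⟨S, -, hS⟩ := isClosed_multiZariski_iff.1 Z.isClosed
    have : p ∈ (Z : Set (ι → PSpace n)) := by
      rw [hS]
      intro f hf
      refine (hI _ _).1 (hle ((hI _ _).2 fun q hq => ?_)) p hp
      have hq' : q ∈ (Z : Set (ι → PSpace n)) := hq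
      rw [hS] at hq'
      exact hq' f hf
    exact this
  exact hanti.wellFoundedLT

end topology

theorem exists_rep_mk_eq_smul {n : ℕ} (v : Fin (n + 1) → ℂ) (hv : v ≠ 0) :
    ∃ c : ℂ, c ≠ 0 ∧ (Projectivization.mk ℂ v hv).rep = c • v := by
  obtain ⟨a, ha⟩ := Projectivization.exists_smul_eq_mk_rep ℂ v hv
  exact ⟨a, a.ne_zero, ha.symm⟩

theorem eval_smul_eq_zero_iff {σ : Type*} [Fintype σ] {f : MvPolynomial σ ℂ} {d : ℕ}
    (hf : f.IsHomogeneous d) {t : ℂ} (ht : t ≠ 0) (z : σ → ℂ) :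
    eval (t • z) f = 0 ↔ eval z f = 0 := by
  rw [eval_smul_of_isHomogeneous hf, mul_eq_zero, or_iff_right (pow_ne_zero d ht)]

theorem eval_rep_mk_eq_zero_iff {n : ℕ} {f : MvPolynomial (Fin (n + 1)) ℂ} {d : ℕ}
    (hf : f.IsHomogeneous d) {v : Fin (n + 1) → ℂ} (hv : v ≠ 0) :
    eval (Projectivization.mk ℂ v hv).rep f = 0 ↔ eval v f = 0 := by
  obtain ⟨c, hc, h⟩ := exists_rep_mk_eq_smul v hv
  rw [h, eval_smul_eq_zero_iff hf hc]

theorem dirDeriv_smul_eq_zero_iff {σ : Type*} [Fintype σ] {f : MvPolynomial σ ℂ} {d : ℕ}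
    (hf : f.IsHomogeneous d) {t : ℂ} (ht : t ≠ 0) (z v : σ → ℂ) :
    dirDeriv (t • z) v f = 0 ↔ dirDeriv z v f = 0 := by
  have : dirDeriv (t • z) v f = t ^ (d - 1) * dirDeriv z v f := by
    simp only [dirDeriv, aeval_eq_eval, Finset.mul_sum]
    refine Finset.sum_congr rfl fun k _ => ?_
    rw [eval_smul_of_isHomogeneous hf.pderiv, mul_assoc]
  rw [this, mul_eq_zero, or_iff_right (pow_ne_zero _ ht)]

/-! ### Locality of the tangent space -/

section tangentCone

variable {n : ℕ}

theorem mem_tangentCone_iff {X : Set (PSpace n)} {p : PSpace n} {v : Fin (n + 1) → ℂ} :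
    v ∈ tangentCone X p ↔ ∀ (f : MvPolynomial (Fin (n + 1)) ℂ) (d : ℕ), f.IsHomogeneous d →
      (∀ x ∈ X, eval x.rep f = 0) → dirDeriv p.rep v f = 0 :=
  Iff.rfl

/-- Closed sets that do not contain a point do not affect the tangent space at that point. -/
theorem tangentCone_le_of_subset_union {W A C : Set (PSpace n)} (hW : W ⊆ A ∪ C)
    (hC : IsClosed[zariski n] C) {w : PSpace n} (hwA : w ∈ A) (hwC : w ∉ C) :
    tangentCone W w ≤ tangentCone A w := by
  intro v hv
  rw [mem_tangentCone_iff] at hv ⊢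
  intro f d hf hfA
  -- Multiplying an equation `f` of `A` by `g`, which vanishes on `C` but not at `w`, gives an
  -- equation of `W`; at `w` its derivative is `g(w)` times that of `f`.
  obtain ⟨g, e, hg, hgC, hgw⟩ := exists_eval_ne_zero_of_notMem hC hwC
  have h1 := hv (f * g) (d + e) (hf.mul hg) fun x hx => by
    rcases hW hx with h | h
    · simp [hfA x h]
    · simp [hgC x h]
  rw [dirDeriv_mul] at h1
  simp only [aeval_eq_eval, hfA w hwA, zero_mul, zero_add] at h1
  exact (mul_eq_zero.1 h1).resolve_left hgw

end tangentCone

theorem exists_eval_coords_eq_eval {ι : Type} {n : ℕ} (p : ι → PSpace n) (f : MvPolynomial (ι × Fin (n + 1)) ℂ) :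
    ∃ F : MvPolynomial ι ℂ, ∀ t, eval t F = eval (coords t p) f := by
  refine ⟨aeval (fun k : ι × Fin (n + 1) => X k.1 * C ((p k.1).rep k.2)) f, fun t => ?_⟩
  rw [← aeval_eq_eval, ← AlgHom.comp_apply, comp_aeval, ← aeval_eq_eval]
  congr 2
  ext k
  simp [coords]

/-! ### Hadamard products, irreducibility and multicones -/

section products

variable {ι : Type} [Fintype ι] {n : ℕ}

/-- The polynomial map given by the Hadamard product of the factors. -/
noncomputable def hadamard (ι : Type) [Fintype ι] (n : ℕ) (j : Fin (n + 1)) :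
    MvPolynomial (ι × Fin (n + 1)) ℂ :=
  ∏ i, X (i, j)

theorem eval_coords_hadamard (t : ι → ℂ) (p : ι → PSpace n) :
    (fun j => eval (coords t p) (hadamard ι n j)) = (∏ i, t i) • fun j => ∏ i, (p i).rep j := by
  ext j
  simp [hadamard, coords, Finset.prod_mul_distrib]

theorem eval_coords_aeval_hadamard (t : ι → ℂ) (p : ι → PSpace n)
    (f : MvPolynomial (Fin (n + 1)) ℂ) :
    eval (coords t p) (aeval (hadamard ι n) f) =
      eval ((∏ i, t i) • fun j => ∏ i, (p i).rep j) f := by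
  rw [← eval_coords_hadamard, ← aeval_eq_eval, ← AlgHom.comp_apply, comp_aeval]
  rfl

variable [DecidableEq ι]

theorem isClosed_eval_prod_eq_zero {f : MvPolynomial (Fin (n + 1)) ℂ} {d : ℕ}
    (hf : f.IsHomogeneous d) :
    IsClosed[multiZariski ι n] {p : ι → PSpace n | eval (fun j => ∏ i, (p i).rep j) f = 0} := by
  convert isClosed_forall_eval_coords (aeval (hadamard ι n) f) using 1
  ext p
  simp only [Set.mem_ofPred_eq, eval_coords_aeval_hadamard]
  constructor
  · intro h t ht
    rw [eval_smul_eq_zero_iff hf (Finset.prod_ne_zero_iff.2 fun i _ => ht i), h]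
  · intro h
    simpa using h 1 (by simp)

/-- The Hadamard product is continuous where it is defined, and it is defined on an open set. -/
theorem exists_isOpen_preimage_starProd {O : Set (PSpace n)} (hO : IsOpen[zariski n] O) :
    ∃ O' : Set (ι → PSpace n), IsOpen[multiZariski ι n] O' ∧
      ∀ p, p ∈ O' ↔ ∃ h : ProdDefined Finset.univ p, starProd Finset.univ p h ∈ O := by
  let _ := multiZariski ι n
  have hc := (@isClosed_compl_iff _ (zariski n) O).2 hO
  obtain ⟨S, hS, hSO⟩ := isClosed_zariski_iff.1 hc
  let C : Set (ι → PSpace n) := ⋂ f ∈ S, {p | eval (fun j => ∏ i, (p i).rep j) f = 0}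
  let E : Set (ι → PSpace n) := ⋂ j : Fin (n + 1),
    {p | eval (fun j => ∏ i, (p i).rep j) (X j : MvPolynomial (Fin (n + 1)) ℂ) = 0}
  have hC : IsClosed C := isClosed_biInter fun f hf =>
    isClosed_eval_prod_eq_zero (hS f hf).choose_spec
  have hE : IsClosed E := isClosed_iInter fun j => isClosed_eval_prod_eq_zero (isHomogeneous_X ℂ j)
  refine ⟨Cᶜ ∩ Eᶜ, hC.isOpen_compl.inter hE.isOpen_compl, fun p => ?_⟩
  have hdef : p ∈ Eᶜ ↔ ProdDefined Finset.univ p := by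
    simp [E, ProdDefined]
  have hmem : ∀ h : ProdDefined Finset.univ p, starProd Finset.univ p h ∈ O ↔ p ∈ Cᶜ := by
    intro h
    rw [← not_iff_not, ← Set.mem_compl_iff, hSO, Set.mem_compl_iff, not_not]
    simp only [zeroLocus, C, Set.mem_ofPred_eq, Set.mem_iInter]
    refine forall₂_congr fun f hf => ?_
    exact eval_rep_mk_eq_zero_iff (hS f hf).choose_spec _
  rw [Set.mem_inter_iff, hdef, and_comm]
  exact ⟨fun h => ⟨h.1, (hmem h.1).2 h.2⟩, fun ⟨h, h'⟩ => ⟨h, (hmem h).1 h'⟩⟩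

/-- The set of defined products of the points of `Z`. -/
def starImage (Z : Set (ι → PSpace n)) : Set (PSpace n) :=
  {s | ∃ p ∈ Z, ∃ h : ProdDefined Finset.univ p, s = starProd Finset.univ p h}

theorem isPreirreducible_starImage {Z : Set (ι → PSpace n)}
    (hZ : @IsPreirreducible _ (multiZariski ι n) Z) :
    @IsPreirreducible _ (zariski n) (starImage Z) := by
  rintro O₁ O₂ h₁ h₂ ⟨_, ⟨p, hp, hdp, rfl⟩, hp'⟩ ⟨_, ⟨q, hq, hdq, rfl⟩, hq'⟩
  obtain ⟨O₁', ho₁, hO₁⟩ := exists_isOpen_preimage_starProd (ι := ι) h₁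
  obtain ⟨O₂', ho₂, hO₂⟩ := exists_isOpen_preimage_starProd (ι := ι) h₂
  obtain ⟨r, hr, hr₁, hr₂⟩ := hZ O₁' O₂' ho₁ ho₂ ⟨p, hp, (hO₁ p).2 ⟨hdp, hp'⟩⟩
    ⟨q, hq, (hO₂ q).2 ⟨hdq, hq'⟩⟩
  obtain ⟨h, hr₁⟩ := (hO₁ r).1 hr₁
  obtain ⟨_, hr₂⟩ := (hO₂ r).1 hr₂
  exact ⟨_, ⟨r, hr, h, rfl⟩, hr₁, hr₂⟩

/-- The inclusion of a factor into a product of projective spaces is continuous. -/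
theorem continuous_update (u : ι → PSpace n) (i : ι) :
    @Continuous _ _ (zariski n) (multiZariski ι n) (Function.update u i) := by
  let _ := zariski n
  let _ := multiZariski ι n
  rw [continuous_iff_isClosed]
  intro Z hZ
  obtain ⟨S, hS, rfl⟩ := isClosed_multiZariski_iff.1 hZ
  let g : ι × Fin (n + 1) → MvPolynomial (Fin (n + 1)) ℂ :=
    fun k => if k.1 = i then X k.2 else C ((u k.1).rep k.2)
  have hg : ∀ (t : ℂ) (p : PSpace n) f, eval (t • p.rep) (aeval g f) =
      eval (fun k : ι × Fin (n + 1) => (Function.update 1 i t : ι → ℂ) k.1 *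
        (Function.update u i p k.1).rep k.2) f := by
    intro t p f
    rw [← aeval_eq_eval, ← AlgHom.comp_apply, comp_aeval, ← aeval_eq_eval]
    congr 2
    ext k
    by_cases h : k.1 = i
    · simp [g, h]
    · simp [g, h]
  have : Function.update u i ⁻¹' multiZeroLocus S =
      ⋂ f ∈ S, {p : PSpace n | ∀ t : ℂ, t ≠ 0 → eval (t • p.rep) (aeval g f) = 0} := by
    ext p
    simp only [Set.mem_preimage, multiZeroLocus, Set.mem_ofPred_eq, Set.mem_iInter]
    refine forall₂_congr fun f hf => ?_
    obtain ⟨d, hd⟩ := hS f hf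
    simp only [hg]
    constructor
    · intro h t _
      rw [eval_mul_of_isMultihomogeneous hd, h, mul_zero]
    · intro h
      simpa using h 1 one_ne_zero
  rw [this]
  exact isClosed_biInter fun f _ => isClosed_forall_eval_smul _

/-- A product of irreducible varieties is irreducible. -/
theorem isPreirreducible_pi {X : ι → Set (PSpace n)} (hX : ∀ i, IsIrred (X i)) :
    @IsPreirreducible _ (multiZariski ι n) {z | ∀ i, z i ∈ X i} := by
  rintro O₁ O₂ h₁ h₂ ⟨u, hu, hu'⟩ ⟨v, hv, hv'⟩
  -- The coordinates of `u` and `v` are made equal one at a time: irreducibility of `X a` provides a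
  -- common value that keeps both points in their open sets.
  have key : ∀ s : Finset ι, ∃ u v : ι → PSpace n, (∀ i, u i ∈ X i) ∧ (∀ i, v i ∈ X i) ∧
      u ∈ O₁ ∧ v ∈ O₂ ∧ ∀ i ∈ s, u i = v i := by
    intro s
    induction s using Finset.induction_on with
    | empty => exact ⟨u, v, hu, hv, hu', hv', by simp⟩
    | insert a s ha ih =>
      obtain ⟨u, v, hu, hv, hu', hv', h⟩ := ih
      obtain ⟨p, hp, hp₁, hp₂⟩ := (hX a).2 _ _
        (@IsOpen.preimage _ _ (zariski n) (multiZariski ι n) _ (continuous_update u a) _ h₁)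
        (@IsOpen.preimage _ _ (zariski n) (multiZariski ι n) _ (continuous_update v a) _ h₂)
        ⟨u a, hu a, by simpa using hu'⟩ ⟨v a, hv a, by simpa using hv'⟩
      refine ⟨Function.update u a p, Function.update v a p, ?_, ?_, hp₁, hp₂, ?_⟩
      · intro i
        by_cases hi : i = a
        · subst hi; simpa using hp
        · simpa [hi] using hu i
      · intro i
        by_cases hi : i = a
        · subst hi; simpa using hp
        · simpa [hi] using hv i
      · intro i hi
        by_cases hia : i = a
        · subst hia; simp
        · simpa [hia] using h i ((Finset.mem_insert.1 hi).resolve_left hia)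
  obtain ⟨u, v, hu, hv, hu', hv', h⟩ := key Finset.univ
  obtain rfl : u = v := funext fun i => h i (Finset.mem_univ i)
  exact ⟨u, hu, hu', hv'⟩

theorem isClosed_pi {X : ι → Set (PSpace n)} (hX : ∀ i, IsVariety (X i)) :
    IsClosed[multiZariski ι n] {z : ι → PSpace n | ∀ i, z i ∈ X i} := by
  let _ := multiZariski ι n
  rw [Set.ofPred_forall]
  refine isClosed_iInter fun i => ?_
  obtain ⟨S, hS, hXS⟩ := isClosed_zariski_iff.1 (hX i)
  have : {z : ι → PSpace n | z i ∈ X i} = ⋂ f ∈ S, {p : ι → PSpace n | ∀ t : ι → ℂ,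
      (∀ i, t i ≠ 0) → eval (coords t p) (rename (fun j => (i, j)) f) = 0} := by
    ext p
    simp only [hXS, zeroLocus, Set.mem_ofPred_eq, Set.mem_iInter, eval_rename]
    refine forall₂_congr fun f hf => ?_
    obtain ⟨d, hd⟩ := hS f hf
    constructor
    · intro h t ht
      exact (eval_smul_eq_zero_iff hd (ht i) _).2 h
    · intro h
      refine (eval_smul_eq_zero_iff hd (one_ne_zero (α := ℂ)) _).1 (h 1 (by simp))
  rw [this]
  exact isClosed_biInter fun f _ => isClosed_forall_eval_coords _

/-- The ideal of the multicone over a set of points of a product of projective spaces. -/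
def coneIdeal (Z : Set (ι → PSpace n)) : Ideal (MvPolynomial (ι × Fin (n + 1)) ℂ) where
  carrier := {f | ∀ p ∈ Z, ∀ t : ι → ℂ, (∀ i, t i ≠ 0) → eval (coords t p) f = 0}
  add_mem' := fun hf hg p hp t ht => by rw [map_add, hf p hp t ht, hg p hp t ht, add_zero]
  zero_mem' := fun p hp t ht => map_zero _
  smul_mem' := fun c f hf p hp t ht => by rw [smul_eq_mul, map_mul, hf p hp t ht, mul_zero]

theorem coneIdeal_isPrime {Z : Set (ι → PSpace n)} (hZ : @IsIrreducible _ (multiZariski ι n) Z) :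
    (coneIdeal Z).IsPrime := by
  let _ := multiZariski ι n
  refine ⟨?_, fun {f g} hfg => ?_⟩
  · obtain ⟨p, hp⟩ := hZ.1
    rw [Ideal.ne_top_iff_one]
    intro h
    simpa using h p hp 1 (by simp)
  · by_contra! hc
    simp only [coneIdeal, Submodule.mem_mk, AddSubmonoid.mem_mk, AddSubsemigroup.mem_mk,
      Set.mem_ofPred_eq, not_forall] at hc
    obtain ⟨⟨p, hp, t, ht, hf⟩, ⟨q, hq, s, hs, hg⟩⟩ := hc
    obtain ⟨r, hr, hr₁, hr₂⟩ := hZ.2 _ _ (isClosed_forall_eval_coords f).isOpen_compl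
      (isClosed_forall_eval_coords g).isOpen_compl ⟨p, hp, fun h => hf (h t ht)⟩
      ⟨q, hq, fun h => hg (h s hs)⟩
    -- At a common point `r` where neither `f` nor `g` vanishes on the whole torus orbit, both
    -- restrict to polynomials in the scaling parameters, and a polynomial ring is a domain.
    obtain ⟨F, hF⟩ := exists_eval_coords_eq_eval r f
    obtain ⟨G, hG⟩ := exists_eval_coords_eq_eval r g
    have hFG : F * G = 0 := eq_zero_of_eval_torus fun t ht => by
      rw [map_mul, hF, hG, ← map_mul]
      exact hfg r hr t ht
    rcases mul_eq_zero.1 hFG with h | h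
    · exact hr₁ fun t _ => by rw [← hF, h, map_zero]
    · exact hr₂ fun t _ => by rw [← hG, h, map_zero]

end products

/-! ### Density of complements -/

section density

/-- Removing from a finite union of irreducible closed sets finitely many closed sets, none of
which contains a maximal member of the union, leaves a dense open subset. -/
theorem isDenseOpenIn_diff_iUnion {α κ μ : Type} [Finite κ] [Finite μ] (τ : TopologicalSpace α)
    {F : κ → Set α} (hF : ∀ a, IsPreirreducible (F a)) {C : μ → Set α} (hC : ∀ k, IsClosed (C k))
    (h : ∀ a k, (∀ b, F a ⊆ F b → F b ⊆ F a) → (F a).Nonempty → ¬ F a ⊆ C k) :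
    IsDenseOpenIn τ (⋃ a, F a) ((⋃ a, F a) \ ⋃ k, C k) := by
  refine ⟨⟨(⋃ k, C k)ᶜ, (isClosed_iUnion_of_finite hC).isOpen_compl, rfl⟩, fun x hx => ?_⟩
  obtain ⟨a, ha⟩ := Set.mem_iUnion.1 hx
  -- Any point of the union lies in a maximal member, where finitely many nonempty relatively open
  -- subsets have a common point.
  obtain ⟨_, hle, ⟨b, rfl⟩, hb⟩ := (Set.finite_range F).exists_le_maximal ⟨a, rfl⟩
  rw [mem_closure_iff]
  intro O hO hxO
  have hirr : IsIrreducible (F b) := ⟨⟨x, hle ha⟩, hF b⟩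
  have := Fintype.ofFinite μ
  classical
  obtain ⟨y, hy, hy'⟩ := isIrreducible_iff_sInter.1 hirr
    (insert O (Finset.univ.image fun k => (C k)ᶜ)) (by
      intro u hu
      rcases Finset.mem_insert.1 hu with rfl | hu
      · exact hO
      · obtain ⟨k, -, rfl⟩ := Finset.mem_image.1 hu
        exact (hC k).isOpen_compl) (by
      intro u hu
      rcases Finset.mem_insert.1 hu with rfl | hu
      · exact ⟨x, hle ha, hxO⟩
      · obtain ⟨k, -, rfl⟩ := Finset.mem_image.1 hu
        exact Set.not_subset.1 (h b k (fun c hc => hb ⟨c, rfl⟩ hc) hirr.1))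
  simp only [Finset.coe_insert, Finset.coe_image, Finset.coe_univ, Set.image_univ, Set.sInter_insert,
    Set.sInter_range, Set.mem_inter_iff, Set.mem_iInter, Set.mem_compl_iff] at hy'
  exact ⟨y, hy'.1, Set.mem_iUnion.2 ⟨b, hy⟩, by simpa using hy'.2⟩

end density

/-! ### Tangent spaces of Hadamard products -/

section tangent

variable {ι : Type} [Fintype ι] [DecidableEq ι] {n : ℕ}

/-- The ideal of the image of a multicone under the Hadamard product is homogeneous. -/
theorem aeval_homogeneousComponent_mem_coneIdeal [Nonempty ι] {Z : Set (ι → PSpace n)}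
    {f : MvPolynomial (Fin (n + 1)) ℂ} (hf : aeval (hadamard ι n) f ∈ coneIdeal Z) {q : ι → PSpace n}
    (hq : q ∈ Z) (d : ℕ) :
    eval (fun j => ∏ i, (q i).rep j) (homogeneousComponent d f) = 0 := by
  refine eval_homogeneousComponent_eq_zero (fun t ht => ?_) d
  let i₀ : ι := Classical.arbitrary ι
  -- Scaling a single factor by `t` scales the product by exactly `t`.
  have h1 := hf q hq (Function.update 1 i₀ t) fun i => by
    by_cases h : i = i₀
    · subst h; simpa using ht
    · simp [h]
  rw [eval_coords_aeval_hadamard, Finset.prod_update_of_mem (Finset.mem_univ _)] at h1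
  simpa using h1

/-- At a general point of an irreducible variety in a product of projective spaces, the tangent
vectors of the Hadamard product come from tangent vectors of the factors. -/
theorem exists_isOpen_tangentCone_decomposition [Nonempty ι] {Z : Set (ι → PSpace n)}
    (hZ : @IsIrreducible _ (multiZariski ι n) Z) :
    ∃ G : Set (ι → PSpace n), IsOpen[multiZariski ι n] G ∧ (Z ∩ G).Nonempty ∧
      ∀ p ∈ Z ∩ G, ∀ h : ProdDefined Finset.univ p,
        ∀ v ∈ tangentCone (@closure _ (zariski n) (starImage Z)) (starProd Finset.univ p h),
          ∃ w : ι → Fin (n + 1) → ℂ,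
            (∀ i, ∀ X : Set (PSpace n), (∀ z ∈ Z, z i ∈ X) → w i ∈ tangentCone X (p i)) ∧
            v = ∑ i, fun j => (∏ k ∈ Finset.univ.erase i, (p k).rep j) * w i j := by
  have := coneIdeal_isPrime hZ
  obtain ⟨g, hg, hgz⟩ := exists_generic_tangent_lift (coneIdeal Z) (hadamard ι n)
  refine ⟨_, (@isOpen_compl_iff _ _ (multiZariski ι n)).2 (isClosed_forall_eval_coords g), ?_, ?_⟩
  · by_contra hne
    refine hg fun p hp => ?_
    by_contra hp'
    exact hne ⟨p, hp, hp'⟩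
  · rintro p ⟨hp, hpG⟩ h v hv
    simp only [Set.mem_compl_iff, Set.mem_ofPred_eq, not_forall] at hpG
    obtain ⟨t, ht, hgt⟩ := hpG
    have hT : ∏ i, t i ≠ 0 := Finset.prod_ne_zero_iff.2 fun i _ => ht i
    obtain ⟨w, hw, hwv⟩ := hgz (coords t p) (fun f hf => hf p hp t ht) hgt v fun f hf => by
      simp only [aeval_eq_eval]
      rw [eval_coords_hadamard, ← sum_homogeneousComponent f, dirDeriv_sum]
      refine Finset.sum_eq_zero fun d _ => ?_
      have hd := homogeneousComponent_isHomogeneous d f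
      rw [dirDeriv_smul_eq_zero_iff hd hT]
      obtain ⟨c, hc, hrep⟩ := exists_rep_mk_eq_smul (fun j => ∏ i, (p i).rep j)
        (fun h0 => h.elim fun j hj => hj (congrFun h0 j))
      have h1 : dirDeriv (starProd Finset.univ p h).rep v (homogeneousComponent d f) = 0 := by
        refine hv _ d hd fun x hx => ?_
        refine @closure_minimal _ (zariski n) _ _ ?_ (isClosed_eval_eq_zero hd) x hx
        rintro _ ⟨q, hq, hdq, rfl⟩
        exact (eval_rep_mk_eq_zero_iff hd _).2 (aeval_homogeneousComponent_mem_coneIdeal hf hq d)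
      rw [starProd, hrep, dirDeriv_smul_eq_zero_iff hd hc] at h1
      exact h1
    -- The lift was taken at the scaled point `coords t p`; this factor absorbs the scalars of the
    -- other factors in the product rule.
    refine ⟨fun i => (∏ k ∈ Finset.univ.erase i, t k) • fun j => w (i, j), fun i X hX => ?_, ?_⟩
    · refine Submodule.smul_mem _ _ fun f d hf hfX => ?_
      -- An equation of `X`, read in the `i`-th group of variables, belongs to the cone ideal of
      -- `Z`.
      have h1 := hw (aeval (fun j => MvPolynomial.X (i, j)) f) fun q hq s hs => by
        rw [← aeval_eq_eval, ← AlgHom.comp_apply, comp_aeval]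
        simp only [aeval_X, coords, aeval_eq_eval]
        exact (eval_smul_eq_zero_iff hf (hs i) _).2 (hfX _ (hX q hq))
      rw [dirDeriv_aeval] at h1
      simp only [aeval_X, dirDeriv_X] at h1
      exact (dirDeriv_smul_eq_zero_iff hf (ht i) _ _).1 h1
    · ext j
      rw [← hwv j, hadamard, dirDeriv_prod, Finset.sum_apply]
      refine Finset.sum_congr rfl fun i _ => ?_
      simp only [dirDeriv_X, aeval_X, coords, Finset.prod_mul_distrib, Pi.smul_apply, smul_eq_mul]
      ring

/-- Tangent vectors of the factors give tangent vectors of the Hadamard product. -/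
theorem prod_erase_mul_mem_tangentCone {X : ι → Set (PSpace n)} {W : Set (PSpace n)}
    (hW : starImage {z | ∀ i, z i ∈ X i} ⊆ W) {p : ι → PSpace n} (hp : ∀ i, p i ∈ X i)
    (h : ProdDefined Finset.univ p) (i : ι) {w : Fin (n + 1) → ℂ}
    (hw : w ∈ tangentCone (X i) (p i)) :
    (fun j => (∏ k ∈ Finset.univ.erase i, (p k).rep j) * w j) ∈
      tangentCone W (starProd Finset.univ p h) := by
  intro f d hf hfW
  set a : Fin (n + 1) → ℂ := fun j => ∏ k ∈ Finset.univ.erase i, (p k).rep j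
  -- `F` is the pullback of `f` under coordinatewise multiplication by the remaining factors `a`; it
  -- vanishes on `X i`, and the chain rule then gives the claim.
  let F : MvPolynomial (Fin (n + 1)) ℂ := aeval (fun j => C (a j) * MvPolynomial.X j) f
  have hF : F.IsHomogeneous d := by
    simpa only [one_mul] using hf.aeval (fun j => C (a j) * MvPolynomial.X j) (n := 1) fun j => isHomogeneous_C_mul_X _ _
  have hFx : ∀ x : Fin (n + 1) → ℂ, eval x F = eval (fun j => a j * x j) f := by
    intro x
    rw [← aeval_eq_eval, ← AlgHom.comp_apply, comp_aeval, ← aeval_eq_eval]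
    simp
  have hprod : ∀ q : PSpace n, (fun j => a j * q.rep j) =
      fun j => ∏ k, (Function.update p i q k).rep j := by
    intro q
    ext j
    rw [← Finset.prod_erase_mul _ _ (Finset.mem_univ i), Function.update_self]
    congr 1
    refine Finset.prod_congr rfl fun k hk => ?_
    rw [Function.update_of_ne (Finset.ne_of_mem_erase hk)]
  obtain ⟨c, hc, hrep⟩ := exists_rep_mk_eq_smul (fun j => ∏ i, (p i).rep j)
    (fun h0 => h.elim fun j hj => hj (congrFun h0 j))
  have hpf : eval (fun j => ∏ i, (p i).rep j) f = 0 :=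
    (eval_rep_mk_eq_zero_iff hf _).1 (hfW _ (hW ⟨p, hp, h, rfl⟩))
  have h1 : dirDeriv (p i).rep w F = 0 := by
    refine hw F d hF fun x hx => ?_
    rw [hFx, hprod]
    by_cases h0 : ProdDefined Finset.univ (Function.update p i x)
    · refine (eval_rep_mk_eq_zero_iff hf _).1 (hfW _ (hW ⟨Function.update p i x, fun k => ?_, h0, rfl⟩))
      by_cases hk : k = i
      · subst hk; simpa using hx
      · simpa [hk] using hp k
    -- Where the product is undefined its coordinate vector is zero. Writing it as `0 •` a point
    -- where `f` vanishes also covers degree `0`, in which `f` need not vanish at the origin for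
    -- formal reasons.
    · have h2 : (fun j => ∏ k, (Function.update p i x k).rep j) =
          (0 : ℂ) • fun j => ∏ i, (p i).rep j := by
        rw [zero_smul]
        ext j
        by_contra hj
        exact h0 ⟨j, hj⟩
      rw [h2, eval_smul_of_isHomogeneous hf, hpf, mul_zero]
  rw [dirDeriv_aeval] at h1
  change dirDeriv (Projectivization.mk ℂ _ _).rep _ f = 0
  rw [hrep, dirDeriv_smul_eq_zero_iff hf hc]
  convert h1 using 2
  · have := hprod (p i)
    rw [Function.update_eq_self] at this
    simp [← this]
  · ext j
    change a j * w j = _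
    simp [dirDeriv_mul, dirDeriv_C, dirDeriv_X]

/-- If the tangent vectors of `W` at a Hadamard product of points come from tangent vectors of the
factors, then its tangent space is spanned by the products with the tangent spaces of the factors. -/
theorem tangentSpace_eq_span {X : ι → Set (PSpace n)} {W : Set (PSpace n)}
    (hW : starImage {z | ∀ i, z i ∈ X i} ⊆ W) {p : ι → PSpace n} (hp : ∀ i, p i ∈ X i)
    (h : ProdDefined Finset.univ p)
    (hle : ∀ v ∈ tangentCone W (starProd Finset.univ p h), ∃ w : ι → Fin (n + 1) → ℂ,
      (∀ i, w i ∈ tangentCone (X i) (p i)) ∧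
        v = ∑ i, fun j => (∏ k ∈ Finset.univ.erase i, (p k).rep j) * w i j) :
    tangentSpace W (starProd Finset.univ p h) =
      Projectivization.Subspace.span (⋃ i, pointStar
        (starProd (Finset.univ.erase i) p (h.mono (Finset.erase_subset i Finset.univ)))
        (tangentSpace (X i) (p i))) := by
  have hrep : ∀ i, ∃ c : ℂ, c ≠ 0 ∧
      (starProd (Finset.univ.erase i) p (h.mono (Finset.erase_subset i Finset.univ))).rep =
        c • fun j => ∏ k ∈ Finset.univ.erase i, (p k).rep j :=
    fun i => exists_rep_mk_eq_smul _ _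
  apply le_antisymm
  · set S := Projectivization.Subspace.span (⋃ i, pointStar
        (starProd (Finset.univ.erase i) p (h.mono (Finset.erase_subset i Finset.univ)))
        (tangentSpace (X i) (p i) : Set (PSpace n))) with hS
    rw [tangentSpace, ← OrderIso.le_symm_apply, OrderIso.symm_symm]
    intro v hv
    obtain ⟨w, hw, rfl⟩ := hle v hv
    refine Submodule.sum_mem _ fun i _ => ?_
    obtain ⟨c, hc, hci⟩ := hrep i
    -- A zero summand corresponds to an undefined product and contributes nothing to the span.
    by_cases h0 : (fun j => (∏ k ∈ Finset.univ.erase i, (p k).rep j) * w i j) = 0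
    · rw [h0]; exact Submodule.zero_mem _
    have hwi : w i ≠ 0 := by
      rintro hwi
      exact h0 (by ext j; simp [hwi])
    rw [Projectivization.Subspace.mem_submodule_iff _ h0, hS]
    refine Projectivization.Subspace.subset_span _ (Set.mem_iUnion.2 ⟨i,
      Projectivization.mk ℂ (w i) hwi, hw i, ?_⟩)
    obtain ⟨e, he, hew⟩ := exists_rep_mk_eq_smul (w i) hwi
    have hmul : (fun j => (starProd (Finset.univ.erase i) p
        (h.mono (Finset.erase_subset i Finset.univ))).rep j *
        (Projectivization.mk ℂ (w i) hwi).rep j) =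
        (c * e) • fun j => (∏ k ∈ Finset.univ.erase i, (p k).rep j) * w i j := by
      ext j
      simp only [hci, hew, Pi.smul_apply, smul_eq_mul]
      ring
    have hdef : StarDefined (starProd (Finset.univ.erase i) p
        (h.mono (Finset.erase_subset i Finset.univ))) (Projectivization.mk ℂ (w i) hwi) := by
      by_contra hnd
      simp only [StarDefined, not_exists, not_not] at hnd
      refine smul_ne_zero (mul_ne_zero hc he) h0 ?_
      rw [← hmul]
      exact funext hnd
    refine ⟨hdef, ?_⟩
    rw [HadamardTerracini.star, Projectivization.mk_eq_mk_iff']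
    exact ⟨(c * e)⁻¹, by rw [hmul, inv_smul_smul₀ (mul_ne_zero hc he)]⟩
  · rw [Projectivization.Subspace.span_le_subspace_iff]
    refine Set.iUnion_subset fun i => ?_
    rintro _ ⟨a, ha, hd, rfl⟩
    obtain ⟨c, hc, hci⟩ := hrep i
    have ha' : a.rep ∈ tangentCone (X i) (p i) := by
      rw [← Submodule.mk_mem_projectivization_iff _ a.rep_nonzero, Projectivization.mk_rep]
      exact ha
    refine (Submodule.mk_mem_projectivization_iff _ _).2 ?_
    have hmul : (fun j => (starProd (Finset.univ.erase i) p
        (h.mono (Finset.erase_subset i Finset.univ))).rep j * a.rep j) =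
        c • fun j => (∏ k ∈ Finset.univ.erase i, (p k).rep j) * a.rep j := by
      ext j
      simp only [hci, Pi.smul_apply, smul_eq_mul]
      ring
    rw [hmul]
    exact Submodule.smul_mem _ _ (prod_erase_mul_mem_tangentCone hW hp h i ha')

end tangent

theorem closure_starImage_iUnion {ι κ : Type} [Fintype ι] [Finite κ] {n : ℕ}
    (Z : κ → Set (ι → PSpace n)) :
    @closure _ (zariski n) (starImage (⋃ a, Z a)) =
      ⋃ a, @closure _ (zariski n) (starImage (Z a)) := by
  let _ := zariski n
  rw [← closure_iUnion_of_finite]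
  congr 1
  ext s
  simp only [starImage, Set.mem_iUnion, Set.mem_ofPred_eq]
  constructor
  · rintro ⟨p, ⟨a, ha⟩, h⟩
    exact ⟨a, p, ha, h⟩
  · rintro ⟨a, p, ha, h⟩
    exact ⟨p, ⟨a, ha⟩, h⟩

/-! ### Terracini's lemma for families -/

section terracini

variable {ι κ : Type} [Fintype ι] [DecidableEq ι] [Nonempty ι] [Finite κ] {n : ℕ}

/-- Terracini's lemma for the Hadamard product of a family of varieties, relative to a decomposition
of their product into irreducible closed sets. -/
theorem terracini_of_iUnion {X : ι → Set (PSpace n)} (Z : κ → Set (ι → PSpace n))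
    (hc : ∀ a, IsClosed[multiZariski ι n] (Z a)) (hZ : ∀ a, @IsIrreducible _ (multiZariski ι n) (Z a))
    (hX : {z | ∀ i, z i ∈ X i} = ⋃ a, Z a) :
    ∃ (U : Set (ι → PSpace n)) (V : Set (PSpace n)),
      IsDenseOpenIn (multiZariski ι n) {z | ∀ i, z i ∈ X i} U ∧
      IsDenseOpenIn (zariski n) (@closure _ (zariski n) (starImage {z | ∀ i, z i ∈ X i})) V ∧
      (Subsingleton κ → V = @closure _ (zariski n) (starImage {z | ∀ i, z i ∈ X i})) ∧
      ∀ p ∈ U, ∀ h : ProdDefined Finset.univ p, starProd Finset.univ p h ∈ V →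
        tangentSpace (@closure _ (zariski n) (starImage {z | ∀ i, z i ∈ X i}))
          (starProd Finset.univ p h) =
        Projectivization.Subspace.span (⋃ i, pointStar
          (starProd (Finset.univ.erase i) p (h.mono (Finset.erase_subset i Finset.univ)))
          (tangentSpace (X i) (p i))) := by
  classical
  choose G hGo hGne hG using fun a => exists_isOpen_tangentCone_decomposition (hZ a)
  let W : κ → Set (PSpace n) := fun a => @closure _ (zariski n) (starImage (Z a))
  have hWc : ∀ a, IsClosed[zariski n] (W a) := fun a => @isClosed_closure _ (zariski n) _
  have hWi : ∀ a, @IsPreirreducible _ (zariski n) (W a) := fun a =>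
    @IsPreirreducible.closure _ (zariski n) _ (isPreirreducible_starImage (hZ a).2)
  -- Different `Z a` may have the same image closure; only intersections of distinct closures are
  -- removed, as otherwise `V` could be empty.
  let C : κ × κ → Set (PSpace n) := fun k => if W k.1 = W k.2 then ∅ else W k.1 ∩ W k.2
  have hWX : @closure _ (zariski n) (starImage {z | ∀ i, z i ∈ X i}) = ⋃ a, W a := by
    rw [hX, closure_starImage_iUnion]
  refine ⟨(⋃ a, Z a) \ ⋃ a, Z a ∩ (G a)ᶜ, (⋃ a, W a) \ ⋃ k, C k, ?_, ?_, ?_, ?_⟩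
  · rw [hX]
    refine isDenseOpenIn_diff_iUnion _ (fun a => (hZ a).2)
      (fun a => @IsClosed.inter _ _ _ (multiZariski ι n) (hc a)
        ((@isClosed_compl_iff _ (multiZariski ι n) _).2 (hGo a))) fun a b hmax _ hsub => ?_
    -- If a maximal `Z a` were inside the bad locus of `Z b`, then `Z a = Z b` and the whole of `Z
    -- b` would be bad.
    obtain ⟨z, hz, hz'⟩ := hGne b
    exact (hsub (hmax b (fun x hx => (hsub hx).1) hz)).2 hz'
  · rw [hWX]
    refine isDenseOpenIn_diff_iUnion _ hWi (fun k => ?_) fun a k hmax hne hsub => ?_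
    · by_cases hk : W k.1 = W k.2
      · simp only [C, if_pos hk]
        exact @isClosed_empty _ (zariski n)
      · simp only [C, if_neg hk]
        exact @IsClosed.inter _ _ _ (zariski n) (hWc _) (hWc _)
    · by_cases hk : W k.1 = W k.2
      · simp only [C, if_pos hk] at hsub
        exact hne.ne_empty (Set.subset_empty_iff.1 hsub)
      · simp only [C, if_neg hk] at hsub
        have h1 : W a ⊆ W k.1 := fun x hx => (hsub hx).1
        have h2 : W a ⊆ W k.2 := fun x hx => (hsub hx).2
        exact hk ((h1.antisymm (hmax _ h1)).symm.trans (h2.antisymm (hmax _ h2)))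
  · intro hκ
    rw [hWX]
    have : ∀ k, C k = ∅ := fun k => if_pos (by rw [Subsingleton.elim k.1 k.2])
    simp [this]
  · rintro p ⟨hp, hpU⟩ h ⟨-, hpV⟩
    obtain ⟨a, ha⟩ := Set.mem_iUnion.1 hp
    have hpX : ∀ i, p i ∈ X i := by
      rw [← hX] at hp
      exact hp
    have hpG : p ∈ G a := by
      by_contra hpG
      exact hpU (Set.mem_iUnion.2 ⟨a, ha, hpG⟩)
    refine tangentSpace_eq_span (@subset_closure _ (zariski n) _) hpX h fun v hv => ?_
    have hsW : starProd Finset.univ p h ∈ W a := @subset_closure _ (zariski n) _ _ ⟨p, ha, h, rfl⟩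
    -- `E` collects the image closures other than `W a`; the choice of `V` keeps the product off
    -- `E`.
    let E : Set (PSpace n) := ⋃ b : {b // W a ≠ W b}, W b.1
    have hE : IsClosed[zariski n] E :=
      @isClosed_iUnion_of_finite _ _ (zariski n) _ _ fun b => hWc b.1
    have hsE : starProd Finset.univ p h ∉ E := by
      intro hsE
      obtain ⟨⟨b, hb⟩, hsb⟩ := Set.mem_iUnion.1 hsE
      refine hpV (Set.mem_iUnion.2 ⟨(a, b), ?_⟩)
      simp only [C, if_neg hb]
      exact ⟨hsW, hsb⟩
    have hsub : @closure _ (zariski n) (starImage {z | ∀ i, z i ∈ X i}) ⊆ W a ∪ E := by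
      rw [hWX]
      refine Set.iUnion_subset fun b => ?_
      by_cases hb : W a = W b
      · rw [← hb]; exact Set.subset_union_left
      · exact (Set.subset_iUnion (fun b : {b // W a ≠ W b} => W b.1) ⟨b, hb⟩).trans
          Set.subset_union_right
    obtain ⟨w, hw, hvw⟩ := hG a p ⟨ha, hpG⟩ h v (tangentCone_le_of_subset_union hsub hE hsW hsE hv)
    refine ⟨w, fun i => hw i _ fun z hz => ?_, hvw⟩
    have hzX : z ∈ {z : ι → PSpace n | ∀ i, z i ∈ X i} := hX ▸ Set.mem_iUnion.2 ⟨a, hz⟩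
    exact hzX i

end terracini

/-- Terracini's lemma for the Hadamard product of a finite family of varieties. -/
theorem terracini {ι : Type} [Fintype ι] [DecidableEq ι] [Nonempty ι] {n : ℕ}
    {X : ι → Set (PSpace n)} (hX : ∀ i, IsVariety (X i)) :
    ∃ (U : Set (ι → PSpace n)) (V : Set (PSpace n)),
      IsDenseOpenIn (multiZariski ι n) {z | ∀ i, z i ∈ X i} U ∧
      IsDenseOpenIn (zariski n) (@closure _ (zariski n) (starImage {z | ∀ i, z i ∈ X i})) V ∧
      ((∀ i, IsIrred (X i)) →
        V = @closure _ (zariski n) (starImage {z | ∀ i, z i ∈ X i})) ∧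
      ∀ p ∈ U, ∀ h : ProdDefined Finset.univ p, starProd Finset.univ p h ∈ V →
        tangentSpace (@closure _ (zariski n) (starImage {z | ∀ i, z i ∈ X i}))
          (starProd Finset.univ p h) =
        Projectivization.Subspace.span (⋃ i, pointStar
          (starProd (Finset.univ.erase i) p (h.mono (Finset.erase_subset i Finset.univ)))
          (tangentSpace (X i) (p i))) := by
  -- Irreducible factors allow the one-piece decomposition, hence the full `V`; otherwise
  -- Noetherianity supplies finitely many irreducible pieces.
  by_cases hirr : ∀ i, IsIrred (X i)
  · obtain ⟨U, V, hU, hV, hVs, h⟩ := terracini_of_iUnion (κ := Unit) (X := X)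
      (fun _ => {z | ∀ i, z i ∈ X i}) (fun _ => isClosed_pi hX) (fun _ => by
        refine ⟨?_, isPreirreducible_pi hirr⟩
        choose x hx using fun i => (hirr i).1
        exact ⟨x, hx⟩) (by rw [Set.iUnion_const])
    exact ⟨U, V, hU, hV, fun _ => hVs inferInstance, h⟩
  · obtain ⟨S, hSf, hSc, hSi, hS⟩ :=
      @TopologicalSpace.NoetherianSpace.exists_finite_set_isClosed_irreducible _ (multiZariski ι n)
        noetherianSpace_multiZariski _ (isClosed_pi hX)
    have := hSf.to_subtype
    obtain ⟨U, V, hU, hV, -, h⟩ := terracini_of_iUnion (κ := S) (X := X) (fun a => a.1)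
      (fun a => hSc a.1 a.2) (fun a => hSi a.1 a.2) (by rw [hS, Set.sUnion_eq_iUnion])
    exact ⟨U, V, hU, hV, fun h' => absurd h' hirr, h⟩

/-! ### Two factors and Hadamard powers -/

variable {n : ℕ}

theorem mk_congr {v w : Fin (n + 1) → ℂ} (h : v = w) (hv : v ≠ 0) (hw : w ≠ 0) :
    Projectivization.mk ℂ v hv = Projectivization.mk ℂ w hw := by
  subst h
  rfl

theorem starProd_singleton_eq {ι : Type} (i : ι) (p : ι → PSpace n) (s : Finset ι) (hs : s = {i})
    (h : ProdDefined s p) : starProd s p h = p i := by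
  subst hs
  rw [← Projectivization.mk_rep (p i)]
  exact mk_congr (by ext j; simp) _ _

theorem prodDefined_pair_iff {p q : PSpace n} :
    ProdDefined Finset.univ ![p, q] ↔ StarDefined p q := by
  simp [ProdDefined, StarDefined, Fin.prod_univ_two]

theorem starProd_pair {p q : PSpace n} (h : ProdDefined Finset.univ ![p, q])
    (h' : StarDefined p q) : starProd Finset.univ ![p, q] h = star p q h' :=
  mk_congr (by ext j; simp [Fin.prod_univ_two]) _ _

theorem starVar_eq_closure_starImage (X Y : Set (PSpace n)) :
    starVar X Y = @closure _ (zariski n)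
      (starImage {z : Fin 2 → PSpace n | ∀ i, z i ∈ (![X, Y] : Fin 2 → Set (PSpace n)) i}) := by
  rw [starVar]
  congr 1
  ext s
  constructor
  · rintro ⟨p, hp, q, hq, h, rfl⟩
    exact ⟨![p, q], by simpa [Fin.forall_fin_two] using ⟨hp, hq⟩, prodDefined_pair_iff.2 h,
      (starProd_pair _ h).symm⟩
  · rintro ⟨z, hz, h, rfl⟩
    obtain ⟨p, q, rfl⟩ : ∃ p q, z = ![p, q] := ⟨z 0, z 1, by ext i; fin_cases i <;> rfl⟩
    have h' := prodDefined_pair_iff.1 h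
    exact ⟨p, hz 0, q, hz 1, h', starProd_pair h h'⟩

theorem isOpen_setOf_star_mem (p : PSpace n) {O : Set (PSpace n)} (hO : IsOpen[zariski n] O) :
    IsOpen[zariski n] {q | ∃ h : StarDefined p q, star p q h ∈ O} := by
  obtain ⟨O', hO', h⟩ := exists_isOpen_preimage_starProd (ι := Fin 2) hO
  convert @IsOpen.preimage _ _ (zariski n) (multiZariski (Fin 2) n) _
    (continuous_update ![p, p] 1) _ hO' using 1
  ext q
  have hq : Function.update ![p, p] 1 q = ![p, q] := by
    ext i; fin_cases i <;> simp
  rw [Set.mem_preimage, hq, h]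
  constructor
  · rintro ⟨h, hs⟩
    exact ⟨prodDefined_pair_iff.2 h, by rwa [starProd_pair _ h]⟩
  · rintro ⟨h, hs⟩
    exact ⟨prodDefined_pair_iff.1 h, by rwa [← starProd_pair h]⟩

/-- Multiplication by a fixed point is continuous on its open domain. This removes the intermediate
closures in the recursive definition of `starPow`. -/
theorem starVar_closure (X A : Set (PSpace n)) :
    starVar X (@closure _ (zariski n) A) = starVar X A := by
  let _ := zariski n
  apply subset_antisymm
  · refine closure_minimal ?_ isClosed_closure
    rintro _ ⟨p, hp, q, hq, h, rfl⟩
    rw [starVar, mem_closure_iff]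
    intro O hO hmem
    obtain ⟨a, ⟨ha, haO⟩, haA⟩ := mem_closure_iff.1 hq _ (isOpen_setOf_star_mem p hO) ⟨h, hmem⟩
    exact ⟨_, haO, p, hp, a, haA, ha, rfl⟩
  · refine closure_mono ?_
    rintro _ ⟨p, hp, q, hq, h⟩
    exact ⟨p, hp, q, subset_closure hq, h⟩

theorem star_starProd_coords {r : ℕ} (p : PSpace n) (z : Fin r → PSpace n)
    (hz : ProdDefined Finset.univ z) : ∃ c : ℂ, c ≠ 0 ∧
      (fun j => p.rep j * (starProd Finset.univ z hz).rep j) =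
        c • fun j => ∏ i, ((Fin.cons p z : Fin (r + 1) → PSpace n) i).rep j := by
  obtain ⟨c, hc, h⟩ := exists_rep_mk_eq_smul (fun j => ∏ i, (z i).rep j)
    (fun h0 => hz.elim fun j hj => hj (congrFun h0 j))
  refine ⟨c, hc, ?_⟩
  ext j
  rw [starProd, h]
  simp only [Fin.prod_univ_succ, Fin.cons_zero, Fin.cons_succ, Pi.smul_apply, smul_eq_mul]
  ring

theorem starDefined_starProd_iff {r : ℕ} (p : PSpace n) (z : Fin r → PSpace n)
    (hz : ProdDefined Finset.univ z) : StarDefined p (starProd Finset.univ z hz) ↔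
      ProdDefined Finset.univ (Fin.cons p z : Fin (r + 1) → PSpace n) := by
  obtain ⟨c, hc, h⟩ := star_starProd_coords p z hz
  refine exists_congr fun j => ?_
  rw [show p.rep j * (starProd Finset.univ z hz).rep j = _ from congrFun h j]
  simp [hc]

theorem star_starProd {r : ℕ} (p : PSpace n) (z : Fin r → PSpace n)
    (hz : ProdDefined Finset.univ z) (h : StarDefined p (starProd Finset.univ z hz))
    (h' : ProdDefined Finset.univ (Fin.cons p z : Fin (r + 1) → PSpace n)) :
    star p (starProd Finset.univ z hz) h = starProd Finset.univ (Fin.cons p z) h' := by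
  obtain ⟨c, hc, hcoord⟩ := star_starProd_coords p z hz
  exact (Projectivization.mk_eq_mk_iff' ℂ _ _ _ _).2 ⟨c, hcoord.symm⟩

theorem starVar_starImage (X : Set (PSpace n)) (r : ℕ) :
    starVar X (starImage {z : Fin r → PSpace n | ∀ i, z i ∈ X}) =
      @closure _ (zariski n) (starImage {z : Fin (r + 1) → PSpace n | ∀ i, z i ∈ X}) := by
  rw [starVar]
  congr 1
  ext s
  constructor
  · rintro ⟨p, hp, _, ⟨z, hz, hdz, rfl⟩, h, rfl⟩
    have h' := (starDefined_starProd_iff p z hdz).1 h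
    exact ⟨Fin.cons p z, Fin.cases (by simpa using hp) (by simpa using hz), h',
      star_starProd p z hdz h h'⟩
  · rintro ⟨y, hy, h, rfl⟩
    obtain ⟨p, z, rfl⟩ : ∃ p z, y = Fin.cons p z := ⟨y 0, Fin.tail y, (Fin.cons_self_tail y).symm⟩
    have hdz : ProdDefined Finset.univ z := by
      obtain ⟨j, hj⟩ := h
      rw [Fin.prod_univ_succ] at hj
      exact ⟨j, by simpa using right_ne_zero_of_mul hj⟩
    have h' := (starDefined_starProd_iff p z hdz).2 h
    exact ⟨p, by simpa using hy 0, _, ⟨z, fun i => by simpa using hy i.succ, hdz, rfl⟩, h',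
      (star_starProd p z hdz h' h).symm⟩

/-- The closure on the left lets the induction start at `r = 0`, where `starPow` is a bare
singleton; for positive `r` it changes nothing. -/
theorem closure_starPow (X : Set (PSpace n)) (r : ℕ) :
    @closure _ (zariski n) (starPow X r) =
      @closure _ (zariski n) (starImage {z : Fin r → PSpace n | ∀ i, z i ∈ X}) := by
  induction r with
  | zero =>
    congr 1
    ext s
    constructor
    · rintro rfl
      exact ⟨Fin.elim0, fun i => i.elim0, ⟨0, by simp⟩, mk_congr (by ext j; simp) _ _⟩
    · rintro ⟨z, -, h, rfl⟩
      exact mk_congr (by ext j; simp) _ _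
  | succ r ih =>
    have : @closure _ (zariski n) (starPow X (r + 1)) = starPow X (r + 1) :=
      @closure_closure _ (zariski n) _
    rw [this, starPow, ← starVar_closure, ih, starVar_closure, starVar_starImage]

theorem starPow_eq_closure_starImage (X : Set (PSpace n)) {r : ℕ} (hr : 1 ≤ r) :
    starPow X r = @closure _ (zariski n) (starImage {z : Fin r → PSpace n | ∀ i, z i ∈ X}) := by
  obtain ⟨r, rfl⟩ := Nat.exists_eq_add_of_le' hr
  rw [← closure_starPow]
  exact (@closure_closure _ (zariski n) _).symm

end HadamardTerracini

theorem lemma2 (n : ℕ) :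
    (∀ X Y : Set (HadamardTerracini.PSpace n),
      HadamardTerracini.IsVariety X → HadamardTerracini.IsVariety Y →
      ∃ (U : Set (Fin 2 → HadamardTerracini.PSpace n)) (V : Set (HadamardTerracini.PSpace n)),
        HadamardTerracini.IsDenseOpenIn (HadamardTerracini.multiZariski (Fin 2) n)
          {z | z 0 ∈ X ∧ z 1 ∈ Y} U ∧
        HadamardTerracini.IsDenseOpenIn (HadamardTerracini.zariski n)
          (HadamardTerracini.starVar X Y) V ∧
        (HadamardTerracini.IsIrred X → HadamardTerracini.IsIrred Y →
          V = HadamardTerracini.starVar X Y) ∧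
        ∀ p q : HadamardTerracini.PSpace n, ![p, q] ∈ U →
          ∀ h : HadamardTerracini.StarDefined p q, HadamardTerracini.star p q h ∈ V →
            HadamardTerracini.tangentSpace (HadamardTerracini.starVar X Y)
                (HadamardTerracini.star p q h) =
              Projectivization.Subspace.span
                (HadamardTerracini.pointStar p (HadamardTerracini.tangentSpace Y q) ∪
                  HadamardTerracini.pointStar q (HadamardTerracini.tangentSpace X p))) ∧
    (∀ (X : Set (HadamardTerracini.PSpace n)) (r : ℕ), 1 ≤ r →
      HadamardTerracini.IsVariety X →
      ∃ (U : Set (Fin r → HadamardTerracini.PSpace n)) (V : Set (HadamardTerracini.PSpace n)),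
        HadamardTerracini.IsDenseOpenIn (HadamardTerracini.multiZariski (Fin r) n)
          {z | ∀ i, z i ∈ X} U ∧
        HadamardTerracini.IsDenseOpenIn (HadamardTerracini.zariski n)
          (HadamardTerracini.starPow X r) V ∧
        (HadamardTerracini.IsIrred X → V = HadamardTerracini.starPow X r) ∧
        ∀ p ∈ U, ∀ h : HadamardTerracini.ProdDefined Finset.univ p,
          HadamardTerracini.starProd Finset.univ p h ∈ V →
            HadamardTerracini.tangentSpace (HadamardTerracini.starPow X r)
                (HadamardTerracini.starProd Finset.univ p h) =
              Projectivization.Subspace.span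
                (⋃ i : Fin r, HadamardTerracini.pointStar
                  (HadamardTerracini.starProd (Finset.univ.erase i) p
                    (h.mono (Finset.erase_subset i Finset.univ)))
                  (HadamardTerracini.tangentSpace X (p i)))) := by
  refine ⟨fun X Y hX hY => ?_, fun X r hr hX => ?_⟩
  · obtain ⟨U, V, hU, hV, hirr, h⟩ := HadamardTerracini.terracini (ι := Fin 2) (X := ![X, Y])
      (by simpa [Fin.forall_fin_two] using ⟨hX, hY⟩)
    rw [← HadamardTerracini.starVar_eq_closure_starImage] at hV hirr h
    refine ⟨U, V, ?_, hV, fun h₁ h₂ => hirr (by simpa [Fin.forall_fin_two] using ⟨h₁, h₂⟩), ?_⟩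
    · simp only [Fin.forall_fin_two] at hU
      exact hU
    · intro p q hpq hd hdV
      have hd' := HadamardTerracini.prodDefined_pair_iff.2 hd
      have hpair := HadamardTerracini.starProd_pair hd' hd
      have := h _ hpq hd' (by rwa [hpair])
      rw [hpair] at this
      rw [this]
      congr 1
      ext s
      -- Omitting index `0` leaves `q`, and omitting index `1` leaves `p`, so the two terms appear
      -- in the opposite order.
      have h0 := HadamardTerracini.starProd_singleton_eq 1 ![p, q]
        (Finset.univ.erase 0) (by decide) (hd'.mono (Finset.erase_subset 0 Finset.univ))
      have h1 := HadamardTerracini.starProd_singleton_eq 0 ![p, q]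
        (Finset.univ.erase 1) (by decide) (hd'.mono (Finset.erase_subset 1 Finset.univ))
      rw [Set.mem_iUnion, Fin.exists_fin_two, h0, h1, or_comm]
      rfl
  · have : NeZero r := ⟨by omega⟩
    obtain ⟨U, V, hU, hV, hirr, h⟩ := HadamardTerracini.terracini (ι := Fin r) (X := fun _ => X)
      fun _ => hX
    rw [← HadamardTerracini.starPow_eq_closure_starImage X hr] at hV hirr h
    exact ⟨U, V, hU, hV, fun hX => hirr fun _ => hX, h⟩
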